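/- Let $q\in\mathbb{C}^\times$ be not a root of unity. Let $\mathcal{O}_q(\mathrm{Mat}_2)$ be the bialgebra generated over $\mathbb{C}$ by $a,b,c,d$ with relations $$ab=qba,\quad ac=qca,\quad bc=cb,\quad bd=qdb,\quad cd=qdc,\quad ad-da=(q-q^{-1})bc,$$ with coproduct $\Delta(a)=a\otimes a+b\otimes c$, $\Delta(b)=a\otimes b+b\otimes d$, $\Delta(c)=c\otimes a+d\otimes c$, $\Delta(d)=c\otimes b+d\otimes d$ and counit $\epsilon(a)=\epsilon(d)=1$, $\epsilon(b)=\epsilon(c)=0$. Let $D_q=ad-qbc$ be the quantum determinant, and let $\mathcal{O}_q(\mathrm{SL}_2)=\mathcal{O}_q(\mathrm{Mat}_2)/\langle D_q-1\rangle$ with the induced bialgebra structure. Let $U_q(\mathfrak{sl}_2)$ be generated by $E,F,K^{\pm1}$ with $KE=q^2EK$, $KF=q^{-2}FK$, $EF-FE=\frac{K-K^{-1}}{q-q^{-1}}$, and with coproduct $\Delta(E)=E\otimes1+K\otimes E$, $\Delta(F)=F\otimes K^{-1}+1\otimes F$, $\Delta(K)=K\otimes K$ and counit $\epsilon(E)=\epsilon(F)=0$,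 $\epsilon(K)=1$. Let $\mathcal{V}_m$ be its irreducible type $1$ module of highest weight $m\ge0$ (of dimension $m+1$). Identify $\mathcal{O}_q(\mathrm{SL}_2)$ with the algebra of matrix coefficients of the modules $\mathcal{V}_m$, inside the dual of $U_q(\mathfrak{sl}_2)$ with the convolution product, by sending $a,b,c,d$ to the four matrix coefficients of $\mathcal{V}_1$ in its standard basis. For an integer $n$, let $\mathcal{O}_q(\mathrm{SL}_2)_{\le n}$ be the subspace of $\mathcal{O}_q(\mathrm{SL}_2)$ that corresponds to the span of the matrix coefficients of the modules $\mathcal{V}_m$ with $0\le m\le n$ and $m\equiv n \bmod 2$ (the Peter–Weyl filtration). Let $z$ be a central variable, and give $\mathcal{O}_q(\mathrm{SL}_2)[z]$ the bialgebra structure with $\Delta(fz^n)=\Delta(f)\cdot(z^n\otimes z^n)$ and $\epsilon(fz^n)=\epsilon(f)$. Then the quantum Vinberg semigroup for $\mathrm{SL}_2$, $$\mathcal{O}_q(\mathbb{V}_{\mathrm{SL}_2})=\bigoplus_{n\ge0}\mathcal{O}_q(\mathrm{SL}_2)_{\le n}\,z^n ,$$ is a sub-bialgebra of $\mathcal{O}_q(\mathrm{SL}_2)[z]$,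 and there is an isomorphism of bialgebras $\mathcal{O}_q(\mathbb{V}_{\mathrm{SL}_2})\simeq\mathcal{O}_q(\mathrm{Mat}_2)$ under which $z^2$ corresponds to $D_q$. -/

import Mathlib

open scoped TensorProduct

noncomputable section

namespace QuantumSL2

/-! ### The quantum matrix algebra -/

/-- The generators of the quantum `2 × 2` matrix algebra. -/
inductive MatGen : Type
  | a | b | c | d

open MatGen in
/-- The defining relations of the quantum `2 × 2` matrix algebra. -/
inductive MatRel (q : ℂˣ) : FreeAlgebra ℂ MatGen → FreeAlgebra ℂ MatGen → Prop
  | ab : MatRel q (.ι ℂ a * .ι ℂ b) ((q : ℂ) • (.ι ℂ b * .ι ℂ a))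
  | ac : MatRel q (.ι ℂ a * .ι ℂ c) ((q : ℂ) • (.ι ℂ c * .ι ℂ a))
  | bc : MatRel q (.ι ℂ b * .ι ℂ c) (.ι ℂ c * .ι ℂ b)
  | bd : MatRel q (.ι ℂ b * .ι ℂ d) ((q : ℂ) • (.ι ℂ d * .ι ℂ b))
  | cd : MatRel q (.ι ℂ c * .ι ℂ d) ((q : ℂ) • (.ι ℂ d * .ι ℂ c))
  | ad : MatRel q (.ι ℂ a * .ι ℂ d - .ι ℂ d * .ι ℂ a)
      (((q : ℂ) - (q : ℂ)⁻¹) • (.ι ℂ b * .ι ℂ c))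

/-- The quantum `2 × 2` matrix algebra `O_q(Mat₂)`. -/
def OqMat2 (q : ℂˣ) : Type := RingQuot (MatRel q)

instance (q : ℂˣ) : Ring (OqMat2 q) := inferInstanceAs (Ring (RingQuot (MatRel q)))

instance (q : ℂˣ) : Algebra ℂ (OqMat2 q) := inferInstanceAs (Algebra ℂ (RingQuot (MatRel q)))

namespace OqMat2

variable {q : ℂˣ}

/-- The quotient map from the free algebra. -/
def mk (q : ℂˣ) : FreeAlgebra ℂ MatGen →ₐ[ℂ] OqMat2 q := RingQuot.mkAlgHom ℂ (MatRel q)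

theorem mk_rel {x y : FreeAlgebra ℂ MatGen} (h : MatRel q x y) : mk q x = mk q y :=
  RingQuot.mkAlgHom_rel ℂ h

/-- The class of a generator in `O_q(Mat₂)`. -/
def gen (q : ℂˣ) (x : MatGen) : OqMat2 q := mk q (.ι ℂ x)

/-- The generator `a` of `O_q(Mat₂)`. -/
abbrev a (q : ℂˣ) : OqMat2 q := gen q .a
/-- The generator `b` of `O_q(Mat₂)`. -/
abbrev b (q : ℂˣ) : OqMat2 q := gen q .b
/-- The generator `c` of `O_q(Mat₂)`. -/
abbrev c (q : ℂˣ) : OqMat2 q := gen q .c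
/-- The generator `d` of `O_q(Mat₂)`. -/
abbrev d (q : ℂˣ) : OqMat2 q := gen q .d

theorem a_mul_b : a q * b q = (q : ℂ) • (b q * a q) := by
  simpa [gen] using mk_rel (MatRel.ab (q := q))

theorem a_mul_c : a q * c q = (q : ℂ) • (c q * a q) := by
  simpa [gen] using mk_rel (MatRel.ac (q := q))

theorem c_mul_b : c q * b q = b q * c q := by
  simpa [gen] using (mk_rel (MatRel.bc (q := q))).symm

theorem b_mul_d : b q * d q = (q : ℂ) • (d q * b q) := by
  simpa [gen] using mk_rel (MatRel.bd (q := q))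

theorem c_mul_d : c q * d q = (q : ℂ) • (d q * c q) := by
  simpa [gen] using mk_rel (MatRel.cd (q := q))

theorem a_mul_d : a q * d q = d q * a q + ((q : ℂ) - (q : ℂ)⁻¹) • (b q * c q) := by
  have h : a q * d q - d q * a q = ((q : ℂ) - (q : ℂ)⁻¹) • (b q * c q) := by
    simpa [gen] using mk_rel (MatRel.ad (q := q))
  rw [← h]; abel

/-- Algebra homomorphisms out of `O_q(Mat₂)` are determined by the images of the generators. -/
theorem hom_ext {B : Type*} [Semiring B] [Algebra ℂ B] {f g : OqMat2 q →ₐ[ℂ] B}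
    (h : ∀ x, f (gen q x) = g (gen q x)) : f = g := by
  apply RingQuot.ringQuot_ext'
  apply FreeAlgebra.hom_ext
  funext x
  exact h x

/-- The universal property of `O_q(Mat₂)`. -/
def lift {B : Type*} [Ring B] [Algebra ℂ B] (f : MatGen → B)
    (hab : f .a * f .b = (q : ℂ) • (f .b * f .a))
    (hac : f .a * f .c = (q : ℂ) • (f .c * f .a))
    (hbc : f .b * f .c = f .c * f .b)
    (hbd : f .b * f .d = (q : ℂ) • (f .d * f .b))
    (hcd : f .c * f .d = (q : ℂ) • (f .d * f .c))
    (had : f .a * f .d - f .d * f .a = ((q : ℂ) - (q : ℂ)⁻¹) • (f .b * f .c)) :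
    OqMat2 q →ₐ[ℂ] B :=
  RingQuot.liftAlgHom ℂ ⟨FreeAlgebra.lift ℂ f, by
    intro x y h
    cases h <;> simp only [map_mul, map_smul, map_sub, FreeAlgebra.lift_ι_apply] <;> assumption⟩

@[simp]
theorem lift_gen {B : Type*} [Ring B] [Algebra ℂ B] (f : MatGen → B)
    (hab hac hbc hbd hcd had) (x : MatGen) :
    lift (q := q) f hab hac hbc hbd hcd had (gen q x) = f x := by
  exact (RingQuot.liftAlgHom_mkAlgHom_apply ℂ (FreeAlgebra.lift ℂ f) _ (.ι ℂ x)).trans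
    (FreeAlgebra.lift_ι_apply f x)

/-- The values of the coproduct on the generators. -/
def comulGen (q : ℂˣ) : MatGen → OqMat2 q ⊗[ℂ] OqMat2 q
  | .a => a q ⊗ₜ a q + b q ⊗ₜ c q
  | .b => a q ⊗ₜ b q + b q ⊗ₜ d q
  | .c => c q ⊗ₜ a q + d q ⊗ₜ c q
  | .d => c q ⊗ₜ b q + d q ⊗ₜ d q

/-- The values of the counit on the generators. -/
def counitGen : MatGen → ℂ
  | .a => 1
  | .b => 0
  | .c => 0
  | .d => 1

/-- The coproduct of `O_q(Mat₂)`. -/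
def comul (q : ℂˣ) : OqMat2 q →ₐ[ℂ] OqMat2 q ⊗[ℂ] OqMat2 q := by
  refine lift (comulGen q) ?_ ?_ ?_ ?_ ?_ (sub_eq_iff_eq_add.2 ?_) <;>
  · simp only [comulGen, add_mul, mul_add, Algebra.TensorProduct.tmul_mul_tmul, a_mul_b, a_mul_c,
      c_mul_b, b_mul_d, c_mul_d, a_mul_d, TensorProduct.tmul_add, TensorProduct.add_tmul,
      TensorProduct.tmul_smul, ← TensorProduct.smul_tmul', smul_add, smul_smul]
    have hq : (q : ℂ) ≠ 0 := q.ne_zero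
    match_scalars <;> field_simp <;> ring

/-- The counit of `O_q(Mat₂)`. -/
def counit (q : ℂˣ) : OqMat2 q →ₐ[ℂ] ℂ := by
  refine lift counitGen ?_ ?_ ?_ ?_ ?_ ?_ <;> simp [counitGen]

@[simp]
theorem comul_gen (x : MatGen) : comul q (gen q x) = comulGen q x := by
  simp [comul]

@[simp]
theorem counit_gen (x : MatGen) : counit q (gen q x) = counitGen x := by
  simp [counit]

instance : Bialgebra ℂ (OqMat2 q) :=
  Bialgebra.ofAlgHom (comul q) (counit q)
    (by
      apply hom_ext
      rintro (_ | _ | _ | _) <;>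
        simp [comulGen, TensorProduct.tmul_add, TensorProduct.add_tmul] <;> abel)
    (by apply hom_ext; rintro (_ | _ | _ | _) <;> simp [comulGen, counitGen])
    (by apply hom_ext; rintro (_ | _ | _ | _) <;> simp [comulGen, counitGen])

/-- The quantum determinant `D_q = ad - q bc`. -/
def qdet (q : ℂˣ) : OqMat2 q := a q * d q - (q : ℂ) • (b q * c q)

theorem comul_qdet : comul q (qdet q) = qdet q ⊗ₜ qdet q := by
  have h : qdet q = a q * d q + (-(q : ℂ)) • (b q * c q) := by
    rw [qdet, neg_smul, sub_eq_add_neg]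
  simp only [h, map_add, map_mul, map_smul, comul_gen, comulGen, add_mul, mul_add,
    Algebra.TensorProduct.tmul_mul_tmul, a_mul_c, c_mul_b, b_mul_d, a_mul_d,
    TensorProduct.tmul_add,
    TensorProduct.add_tmul, TensorProduct.tmul_smul, ← TensorProduct.smul_tmul', smul_add,
    smul_smul]
  have hq : (q : ℂ) ≠ 0 := q.ne_zero
  match_scalars <;> field_simp <;> ring

theorem counit_qdet : counit q (qdet q) = 1 := by
  simp [qdet, counitGen]

end OqMat2

/-! ### The quantum coordinate algebra of `SL₂` -/

/-- The relation imposing that the quantum determinant equals `1`. -/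
inductive DetRel (q : ℂˣ) : OqMat2 q → OqMat2 q → Prop
  | det : DetRel q (OqMat2.qdet q) 1

/-- The quantum coordinate algebra `O_q(SL₂)`: the quotient of `O_q(Mat₂)` by the two-sided ideal
generated by `D_q - 1`. -/
def OqSL2 (q : ℂˣ) : Type := RingQuot (DetRel q)

instance (q : ℂˣ) : Ring (OqSL2 q) := inferInstanceAs (Ring (RingQuot (DetRel q)))

instance (q : ℂˣ) : Algebra ℂ (OqSL2 q) := inferInstanceAs (Algebra ℂ (RingQuot (DetRel q)))

namespace OqSL2

variable {q : ℂˣ}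

/-- The quotient map `O_q(Mat₂) → O_q(SL₂)`. -/
def mk (q : ℂˣ) : OqMat2 q →ₐ[ℂ] OqSL2 q := RingQuot.mkAlgHom ℂ (DetRel q)

theorem mk_qdet : mk q (OqMat2.qdet q) = 1 := by
  have h : mk q (OqMat2.qdet q) = mk q 1 := RingQuot.mkAlgHom_rel ℂ DetRel.det
  rw [h, map_one]

/-- Algebra homomorphisms out of `O_q(SL₂)` are determined by the images of the generators. -/
theorem hom_ext {B : Type*} [Semiring B] [Algebra ℂ B] {f g : OqSL2 q →ₐ[ℂ] B}
    (h : ∀ x, f (mk q (OqMat2.gen q x)) = g (mk q (OqMat2.gen q x))) : f = g := by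
  apply RingQuot.ringQuot_ext'
  apply OqMat2.hom_ext
  exact h

/-- The universal property of `O_q(SL₂)`. -/
def lift {B : Type*} [Ring B] [Algebra ℂ B] (f : OqMat2 q →ₐ[ℂ] B)
    (hf : f (OqMat2.qdet q) = 1) : OqSL2 q →ₐ[ℂ] B :=
  RingQuot.liftAlgHom ℂ ⟨f, by rintro _ _ ⟨⟩; rw [hf, map_one]⟩

@[simp]
theorem lift_mk {B : Type*} [Ring B] [Algebra ℂ B] (f : OqMat2 q →ₐ[ℂ] B)
    (hf : f (OqMat2.qdet q) = 1) (x : OqMat2 q) : lift f hf (mk q x) = f x := by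
  exact RingQuot.liftAlgHom_mkAlgHom_apply ℂ f _ x

/-- The coproduct of `O_q(SL₂)`, induced by that of `O_q(Mat₂)`. -/
def comul (q : ℂˣ) : OqSL2 q →ₐ[ℂ] OqSL2 q ⊗[ℂ] OqSL2 q :=
  lift ((Algebra.TensorProduct.map (mk q) (mk q)).comp (OqMat2.comul q)) (by
    rw [AlgHom.comp_apply, OqMat2.comul_qdet, Algebra.TensorProduct.map_tmul, mk_qdet,
      Algebra.TensorProduct.one_def])

/-- The counit of `O_q(SL₂)`, induced by that of `O_q(Mat₂)`. -/
def counit (q : ℂˣ) : OqSL2 q →ₐ[ℂ] ℂ := lift (OqMat2.counit q) OqMat2.counit_qdet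

instance : Bialgebra ℂ (OqSL2 q) :=
  Bialgebra.ofAlgHom (comul q) (counit q)
    (by
      apply hom_ext
      rintro (_ | _ | _ | _) <;>
        simp [comul, OqMat2.comulGen, TensorProduct.tmul_add, TensorProduct.add_tmul] <;> abel)
    (by
      apply hom_ext
      rintro (_ | _ | _ | _) <;> simp [comul, counit, OqMat2.comulGen, OqMat2.counitGen])
    (by
      apply hom_ext
      rintro (_ | _ | _ | _) <;> simp [comul, counit, OqMat2.comulGen, OqMat2.counitGen])

end OqSL2

/-! ### The quantized enveloping algebra of `sl₂` -/

/-- The generators of `U_q(sl₂)`; `Kinv` stands for the inverse of `K`. -/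
inductive UGen : Type
  | E | F | K | Kinv

open UGen in
/-- The defining relations of `U_q(sl₂)`. -/
inductive URel (q : ℂˣ) : FreeAlgebra ℂ UGen → FreeAlgebra ℂ UGen → Prop
  | K_Kinv : URel q (.ι ℂ K * .ι ℂ Kinv) 1
  | Kinv_K : URel q (.ι ℂ Kinv * .ι ℂ K) 1
  | K_E : URel q (.ι ℂ K * .ι ℂ E) ((q : ℂ) ^ 2 • (.ι ℂ E * .ι ℂ K))
  | K_F : URel q (.ι ℂ K * .ι ℂ F) (((q : ℂ) ^ 2)⁻¹ • (.ι ℂ F * .ι ℂ K))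
  | E_F : URel q (.ι ℂ E * .ι ℂ F - .ι ℂ F * .ι ℂ E)
      (((q : ℂ) - (q : ℂ)⁻¹)⁻¹ • (.ι ℂ K - .ι ℂ Kinv))

/-- The quantized enveloping algebra `U_q(sl₂)`. -/
def Uq (q : ℂˣ) : Type := RingQuot (URel q)

instance (q : ℂˣ) : Ring (Uq q) := inferInstanceAs (Ring (RingQuot (URel q)))

instance (q : ℂˣ) : Algebra ℂ (Uq q) := inferInstanceAs (Algebra ℂ (RingQuot (URel q)))

namespace Uq

variable {q : ℂˣ}

/-- The quotient map from the free algebra. -/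
def mk (q : ℂˣ) : FreeAlgebra ℂ UGen →ₐ[ℂ] Uq q := RingQuot.mkAlgHom ℂ (URel q)

theorem mk_rel {x y : FreeAlgebra ℂ UGen} (h : URel q x y) : mk q x = mk q y :=
  RingQuot.mkAlgHom_rel ℂ h

theorem mk_surjective : Function.Surjective (mk q) := RingQuot.mkAlgHom_surjective ℂ (URel q)

/-- The class of a generator in `U_q(sl₂)`. -/
def gen (q : ℂˣ) (x : UGen) : Uq q := mk q (.ι ℂ x)

/-- The generator `E`. -/
abbrev E (q : ℂˣ) : Uq q := gen q .E
/-- The generator `F`. -/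
abbrev F (q : ℂˣ) : Uq q := gen q .F
/-- The generator `K`. -/
abbrev K (q : ℂˣ) : Uq q := gen q .K
/-- The generator `K⁻¹`. -/
abbrev Kinv (q : ℂˣ) : Uq q := gen q .Kinv

theorem K_mul_Kinv : K q * Kinv q = 1 := by simpa [gen] using mk_rel (URel.K_Kinv (q := q))

theorem Kinv_mul_K : Kinv q * K q = 1 := by simpa [gen] using mk_rel (URel.Kinv_K (q := q))

theorem K_mul_E : K q * E q = (q : ℂ) ^ 2 • (E q * K q) := by
  simpa [gen] using mk_rel (URel.K_E (q := q))

theorem K_mul_F : K q * F q = ((q : ℂ) ^ 2)⁻¹ • (F q * K q) := by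
  simpa [gen] using mk_rel (URel.K_F (q := q))

theorem Kinv_mul_E : Kinv q * E q = ((q : ℂ) ^ 2)⁻¹ • (E q * Kinv q) := by
  have hq : (q : ℂ) ^ 2 ≠ 0 := pow_ne_zero 2 q.ne_zero
  have h : Kinv q * (K q * E q) * Kinv q = (q : ℂ) ^ 2 • (Kinv q * E q) := by
    rw [K_mul_E, mul_smul_comm, smul_mul_assoc, mul_assoc, mul_assoc, K_mul_Kinv, mul_one]
  rw [← mul_assoc, Kinv_mul_K, one_mul] at h
  rw [h, smul_smul, inv_mul_cancel₀ hq, one_smul]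

theorem Kinv_mul_F : Kinv q * F q = (q : ℂ) ^ 2 • (F q * Kinv q) := by
  have hq : (q : ℂ) ^ 2 ≠ 0 := pow_ne_zero 2 q.ne_zero
  have h : Kinv q * (K q * F q) * Kinv q = ((q : ℂ) ^ 2)⁻¹ • (Kinv q * F q) := by
    rw [K_mul_F, mul_smul_comm, smul_mul_assoc, mul_assoc, mul_assoc, K_mul_Kinv, mul_one]
  rw [← mul_assoc, Kinv_mul_K, one_mul] at h
  rw [h, smul_smul, mul_inv_cancel₀ hq, one_smul]

theorem E_mul_F : E q * F q = F q * E q +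
    (((q : ℂ) - (q : ℂ)⁻¹)⁻¹ • K q + (-((q : ℂ) - (q : ℂ)⁻¹)⁻¹) • Kinv q) := by
  have h : E q * F q - F q * E q = ((q : ℂ) - (q : ℂ)⁻¹)⁻¹ • (K q - Kinv q) := by
    simpa [gen] using mk_rel (URel.E_F (q := q))
  rw [sub_eq_iff_eq_add] at h
  rw [h, smul_sub, neg_smul, sub_eq_add_neg, add_comm]

theorem hom_ext {B : Type*} [Semiring B] [Algebra ℂ B] {f g : Uq q →ₐ[ℂ] B}
    (h : ∀ x, f (gen q x) = g (gen q x)) : f = g := by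
  apply RingQuot.ringQuot_ext'
  apply FreeAlgebra.hom_ext
  funext x
  exact h x

/-- The universal property of `U_q(sl₂)`. -/
def lift {B : Type*} [Ring B] [Algebra ℂ B] (f : UGen → B)
    (h₁ : f .K * f .Kinv = 1) (h₂ : f .Kinv * f .K = 1)
    (h₃ : f .K * f .E = (q : ℂ) ^ 2 • (f .E * f .K))
    (h₄ : f .K * f .F = ((q : ℂ) ^ 2)⁻¹ • (f .F * f .K))
    (h₅ : f .E * f .F - f .F * f .E = ((q : ℂ) - (q : ℂ)⁻¹)⁻¹ • (f .K - f .Kinv)) :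
    Uq q →ₐ[ℂ] B :=
  RingQuot.liftAlgHom ℂ ⟨FreeAlgebra.lift ℂ f, by
    intro x y h
    cases h <;>
      simp only [map_mul, map_smul, map_sub, map_one, FreeAlgebra.lift_ι_apply] <;> assumption⟩

@[simp]
theorem lift_gen {B : Type*} [Ring B] [Algebra ℂ B] (f : UGen → B) (h₁ h₂ h₃ h₄ h₅) (x : UGen) :
    lift (q := q) f h₁ h₂ h₃ h₄ h₅ (gen q x) = f x := by
  exact (RingQuot.liftAlgHom_mkAlgHom_apply ℂ (FreeAlgebra.lift ℂ f) _ (.ι ℂ x)).trans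
    (FreeAlgebra.lift_ι_apply f x)

/-- The values of the coproduct on the generators. -/
def comulGen (q : ℂˣ) : UGen → Uq q ⊗[ℂ] Uq q
  | .E => E q ⊗ₜ 1 + K q ⊗ₜ E q
  | .F => F q ⊗ₜ Kinv q + 1 ⊗ₜ F q
  | .K => K q ⊗ₜ K q
  | .Kinv => Kinv q ⊗ₜ Kinv q

/-- The values of the counit on the generators. -/
def counitGen : UGen → ℂ
  | .E => 0
  | .F => 0
  | .K => 1
  | .Kinv => 1

/-- The coproduct of `U_q(sl₂)`. -/
def comul (q : ℂˣ) : Uq q →ₐ[ℂ] Uq q ⊗[ℂ] Uq q := by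
  have hq : (q : ℂ) ≠ 0 := q.ne_zero
  refine lift (comulGen q) ?_ ?_ ?_ ?_ (sub_eq_iff_eq_add.2 ?_)
  · simp [comulGen, K_mul_Kinv, Algebra.TensorProduct.one_def]
  · simp [comulGen, Kinv_mul_K, Algebra.TensorProduct.one_def]
  · simp [comulGen, mul_add, add_mul, K_mul_E, TensorProduct.smul_tmul']
  · simp [comulGen, mul_add, add_mul, K_mul_F, K_mul_Kinv, Kinv_mul_K, TensorProduct.smul_tmul']
  · have h (x y : Uq q ⊗[ℂ] Uq q) : x - y = x + (-1 : ℂ) • y := by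
      rw [neg_one_smul, sub_eq_add_neg]
    simp only [comulGen, add_mul, mul_add, Algebra.TensorProduct.tmul_mul_tmul, one_mul, mul_one,
      K_mul_F, Kinv_mul_E, E_mul_F, TensorProduct.tmul_add, TensorProduct.add_tmul,
      TensorProduct.tmul_smul, ← TensorProduct.smul_tmul', smul_add, smul_smul, h]
    match_scalars <;> field_simp <;> ring

/-- The counit of `U_q(sl₂)`. -/
def counit (q : ℂˣ) : Uq q →ₐ[ℂ] ℂ := by
  refine lift counitGen ?_ ?_ ?_ ?_ ?_ <;> simp [counitGen]

@[simp]
theorem comul_gen (x : UGen) : comul q (gen q x) = comulGen q x := by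
  simp [comul]

@[simp]
theorem counit_gen (x : UGen) : counit q (gen q x) = counitGen x := by
  simp [counit]

instance : Bialgebra ℂ (Uq q) :=
  Bialgebra.ofAlgHom (comul q) (counit q)
    (by
      apply hom_ext
      rintro (_ | _ | _ | _) <;>
        simp [comulGen, TensorProduct.tmul_add, TensorProduct.add_tmul,
          Algebra.TensorProduct.one_def, add_assoc])
    (by apply hom_ext; rintro (_ | _ | _ | _) <;> simp [comulGen, counitGen])
    (by apply hom_ext; rintro (_ | _ | _ | _) <;> simp [comulGen, counitGen])

end Uq

/-! ### The irreducible modules of type `1` -/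

/-- The quantum integer `[n] = (q ^ n - q ^ (-n)) / (q - q⁻¹)`. -/
def qInt (q : ℂˣ) (n : ℤ) : ℂ := ((q : ℂ) ^ n - (q : ℂ) ^ (-n)) / ((q : ℂ) - (q : ℂ)⁻¹)

/-- The vector space underlying the irreducible type `1` module of highest weight `m`. Its standard
basis `v₀, …, v_m` consists of weight vectors, and `v₀` is a highest weight vector. -/
abbrev V (m : ℕ) : Type := Fin (m + 1) → ℂ

namespace V

variable {q : ℂˣ} {m : ℕ}

/-- `E v_j = [m - j + 1] v_{j-1}`, with `E v₀ = 0`. -/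
def opE (q : ℂˣ) (m : ℕ) : Module.End ℂ (V m) where
  toFun f i := if h : (i : ℕ) < m then qInt q (m - i) * f ⟨i + 1, by omega⟩ else 0
  map_add' f g := by ext i; simp only [Pi.add_apply]; split_ifs <;> ring
  map_smul' c f := by
    ext i; simp only [Pi.smul_apply, smul_eq_mul, RingHom.id_apply]; split_ifs <;> ring

/-- `F v_j = [j + 1] v_{j+1}`, with `F v_m = 0`. -/
def opF (q : ℂˣ) (m : ℕ) : Module.End ℂ (V m) where
  toFun f i := if 0 < (i : ℕ) then qInt q i * f ⟨i - 1, by omega⟩ else 0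
  map_add' f g := by ext i; simp only [Pi.add_apply]; split_ifs <;> ring
  map_smul' c f := by
    ext i; simp only [Pi.smul_apply, smul_eq_mul, RingHom.id_apply]; split_ifs <;> ring

/-- `K v_j = q ^ (m - 2 j) v_j`. -/
def opK (q : ℂˣ) (m : ℕ) : Module.End ℂ (V m) where
  toFun f i := (q : ℂ) ^ ((m : ℤ) - 2 * i) * f i
  map_add' f g := by ext i; simp only [Pi.add_apply]; ring
  map_smul' c f := by ext i; simp only [Pi.smul_apply, smul_eq_mul, RingHom.id_apply]; ring

/-- `K⁻¹ v_j = q ^ (-(m - 2 j)) v_j`. -/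
def opKinv (q : ℂˣ) (m : ℕ) : Module.End ℂ (V m) where
  toFun f i := (q : ℂ) ^ (-((m : ℤ) - 2 * i)) * f i
  map_add' f g := by ext i; simp only [Pi.add_apply]; ring
  map_smul' c f := by ext i; simp only [Pi.smul_apply, smul_eq_mul, RingHom.id_apply]; ring

/-- The action of the generators of `U_q(sl₂)`. -/
def opGen (q : ℂˣ) (m : ℕ) : UGen → Module.End ℂ (V m)
  | .E => opE q m
  | .F => opF q m
  | .K => opK q m
  | .Kinv => opKinv q m

theorem opE_apply (f : V m) (i : Fin (m + 1)) :
    opE q m f i = if h : (i : ℕ) < m then qInt q (m - i) * f ⟨i + 1, by omega⟩ else 0 := rfl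

theorem opF_apply (f : V m) (i : Fin (m + 1)) :
    opF q m f i = if 0 < (i : ℕ) then qInt q i * f ⟨i - 1, by omega⟩ else 0 := rfl

theorem opK_apply (f : V m) (i : Fin (m + 1)) :
    opK q m f i = (q : ℂ) ^ ((m : ℤ) - 2 * i) * f i := rfl

theorem opKinv_apply (f : V m) (i : Fin (m + 1)) :
    opKinv q m f i = (q : ℂ) ^ (-((m : ℤ) - 2 * i)) * f i := rfl

theorem qInt_identity (i n : ℤ) :
    qInt q (n - i) * qInt q (i + 1) - qInt q i * qInt q (n - i + 1) =
      ((q : ℂ) - (q : ℂ)⁻¹)⁻¹ * ((q : ℂ) ^ (n - 2 * i) - (q : ℂ) ^ (-(n - 2 * i))) := by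
  have hq : (q : ℂ) ≠ 0 := q.ne_zero
  have h : ((q : ℂ) ^ (n - i) - (q : ℂ) ^ (-(n - i))) * ((q : ℂ) ^ (i + 1) - (q : ℂ) ^ (-(i + 1))) -
      ((q : ℂ) ^ i - (q : ℂ) ^ (-i)) * ((q : ℂ) ^ (n - i + 1) - (q : ℂ) ^ (-(n - i + 1))) =
      ((q : ℂ) - (q : ℂ)⁻¹) * ((q : ℂ) ^ (n - 2 * i) - (q : ℂ) ^ (-(n - 2 * i))) := by
    rw [← zpow_neg_one (q : ℂ)]
    nth_rewrite 9 [← zpow_one (q : ℂ)]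
    simp only [sub_mul, mul_sub, ← zpow_add₀ hq]
    ring_nf
  by_cases h0 : (q : ℂ) - (q : ℂ)⁻¹ = 0
  · simp [qInt, h0]
  · have h1 := inv_mul_cancel₀ h0
    simp only [qInt, div_eq_mul_inv]
    generalize ((q : ℂ) - (q : ℂ)⁻¹)⁻¹ = s at h1 ⊢
    linear_combination s * s * h +
      s * ((q : ℂ) ^ (n - 2 * i) - (q : ℂ) ^ (-(n - 2 * i))) * h1

/-- The action of `U_q(sl₂)` on its irreducible type `1` module of highest weight `m`. -/
def rep (q : ℂˣ) (m : ℕ) : Uq q →ₐ[ℂ] Module.End ℂ (V m) := by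
  have hq : (q : ℂ) ≠ 0 := q.ne_zero
  refine Uq.lift (opGen q m) ?_ ?_ ?_ ?_ ?_ <;>
    refine LinearMap.ext fun f => funext fun i => ?_
  · simp only [opGen, Module.End.mul_apply, opK_apply, opKinv_apply, Module.End.one_apply]
    rw [← mul_assoc, ← zpow_add₀ hq, add_neg_cancel, zpow_zero, one_mul]
  · simp only [opGen, Module.End.mul_apply, opK_apply, opKinv_apply, Module.End.one_apply]
    rw [← mul_assoc, ← zpow_add₀ hq, neg_add_cancel, zpow_zero, one_mul]
  · simp only [opGen, Module.End.mul_apply, opK_apply, opE_apply, LinearMap.smul_apply,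
      Pi.smul_apply, smul_eq_mul]
    split_ifs with h
    · have e : (q : ℂ) ^ ((m : ℤ) - 2 * (i : ℕ)) =
          (q : ℂ) ^ 2 * (q : ℂ) ^ ((m : ℤ) - 2 * ((i : ℕ) + 1 : ℕ)) := by
        rw [← zpow_natCast, ← zpow_add₀ hq]; congr 1; push_cast; ring
      rw [e]; ring
    · simp
  · simp only [opGen, Module.End.mul_apply, opK_apply, opF_apply, LinearMap.smul_apply,
      Pi.smul_apply, smul_eq_mul]
    split_ifs with h
    · have e : (q : ℂ) ^ ((m : ℤ) - 2 * (i : ℕ)) =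
          ((q : ℂ) ^ 2)⁻¹ * (q : ℂ) ^ ((m : ℤ) - 2 * ((i : ℕ) - 1 : ℕ)) := by
        rw [← zpow_natCast, ← zpow_neg, ← zpow_add₀ hq]
        congr 1
        rw [Nat.cast_sub h]; push_cast; ring
      rw [e]; ring
    · simp
  · simp only [opGen, Module.End.mul_apply, opK_apply, opKinv_apply, opE_apply, opF_apply,
      LinearMap.smul_apply, LinearMap.sub_apply, Pi.sub_apply, Pi.smul_apply, smul_eq_mul]
    have key := qInt_identity (q := q) (i : ℕ) m
    have z0 : qInt q 0 = 0 := by simp [qInt]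
    rw [← sub_mul, ← mul_assoc, ← key]
    obtain ⟨i, hi⟩ := i
    rcases Nat.eq_zero_or_pos i with rfl | hpos
    · rcases Nat.eq_zero_or_pos m with rfl | hm
      · simp [z0]
      · simp [hm, z0, mul_assoc]
    · have e1 : i - 1 + 1 = i := by omega
      have e2 : i - 1 < m := by omega
      have e3 : (m : ℤ) - ((i - 1 : ℕ) : ℤ) = m - i + 1 := by omega
      by_cases h : i < m
      · simp only [hpos, h, e1, e2, e3, Nat.add_sub_cancel, Nat.zero_lt_succ, if_true, dif_pos,
          Nat.cast_add, Nat.cast_one]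
        ring
      · obtain rfl : m = i := by omega
        simp only [hpos, e1, e2, e3, if_true, dif_pos, lt_irrefl, dif_neg, not_false_iff, sub_self,
          z0]
        ring

@[simp]
theorem rep_gen (x : UGen) : rep q m (Uq.gen q x) = opGen q m x := by
  simp [rep]

end V

/-! ### Matrix coefficients and the Peter–Weyl filtration -/

/-- The matrix coefficient `u ↦ φ (u v)` of the irreducible module `V m`. -/
def matrixCoeff (q : ℂˣ) (m : ℕ) (φ : Module.Dual ℂ (V m)) (v : V m) : Module.Dual ℂ (Uq q) :=
  φ ∘ₗ LinearMap.applyₗ v ∘ₗ (V.rep q m).toLinearMap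

@[simp]
theorem matrixCoeff_apply (q : ℂˣ) (m : ℕ) (φ : Module.Dual ℂ (V m)) (v : V m) (u : Uq q) :
    matrixCoeff q m φ v u = φ (V.rep q m u v) := rfl

/-- The matrix coefficients of the standard representation `V 1` with respect to its standard
basis. -/
def stdCoeff (q : ℂˣ) (i j : Fin 2) : WithConv (Uq q →ₗ[ℂ] ℂ) :=
  .toConv (matrixCoeff q 1 (LinearMap.proj i) (Pi.single j 1))

/-- The generators `a, b, c, d` correspond to the four entries of the standard representation. -/
def pairingGen (q : ℂˣ) : MatGen → WithConv (Uq q →ₗ[ℂ] ℂ)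
  | .a => stdCoeff q 0 0
  | .b => stdCoeff q 0 1
  | .c => stdCoeff q 1 0
  | .d => stdCoeff q 1 1

namespace Pairing

variable {q : ℂˣ}

/-- The action of `U_q(sl₂)` on the tensor square of the standard representation. -/
def tensorRep (q : ℂˣ) : Uq q →ₐ[ℂ] Module.End ℂ (V 1 ⊗[ℂ] V 1) :=
  Module.endTensorEndAlgHom.comp
    ((Algebra.TensorProduct.map (V.rep q 1) (V.rep q 1)).comp (Uq.comul q))

/-- The tensor product of two functionals. -/
def tensorFun (φ ψ : Module.Dual ℂ (V 1)) : V 1 ⊗[ℂ] V 1 →ₗ[ℂ] ℂ :=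
  LinearMap.mul' ℂ ℂ ∘ₗ TensorProduct.map φ ψ

theorem stdCoeff_mul (i j k l : Fin 2) (u : Uq q) :
    (stdCoeff q i j * stdCoeff q k l) u = tensorFun (LinearMap.proj i) (LinearMap.proj k)
      (tensorRep q u ((Pi.single j 1 : V 1) ⊗ₜ (Pi.single l 1 : V 1))) := by
  have h (t : Uq q ⊗[ℂ] Uq q) :
      LinearMap.mul' ℂ ℂ (TensorProduct.map (stdCoeff q i j).ofConv (stdCoeff q k l).ofConv t) =
      tensorFun (LinearMap.proj i) (LinearMap.proj k) (Module.endTensorEndAlgHom (R := ℂ) (S := ℂ)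
        (A := ℂ) (Algebra.TensorProduct.map (V.rep q 1) (V.rep q 1) t)
        ((Pi.single j 1 : V 1) ⊗ₜ (Pi.single l 1 : V 1))) := by
    induction t with
    | zero => simp
    | tmul x y =>
      rw [Algebra.TensorProduct.map_tmul, Module.endTensorEndAlgHom_apply]
      simp [tensorFun, stdCoeff]
    | add x y hx hy => simp only [map_add, LinearMap.add_apply, hx, hy]
  exact h (Uq.comul q u)

theorem tensorRep_invariant (w : V 1 ⊗[ℂ] V 1)
    (hw : ∀ x, tensorRep q (Uq.gen q x) w = Uq.counitGen x • w) (u : Uq q) :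
    tensorRep q u w = Uq.counit q u • w := by
  obtain ⟨u, rfl⟩ := Uq.mk_surjective u
  induction u using FreeAlgebra.induction with
  | grade0 r => simp [AlgHom.commutes, Module.algebraMap_end_apply]
  | grade1 x => simpa [Uq.gen] using (hw x).trans (by rw [← Uq.counit_gen (q := q) x]; rfl)
  | mul x y hx hy => simp [hx, hy, smul_smul, mul_comm]
  | add x y hx hy => simp [hx, hy, add_smul]

theorem tensorRep_coinvariant (w : V 1 ⊗[ℂ] V 1 →ₗ[ℂ] ℂ)
    (hw : ∀ x, w ∘ₗ tensorRep q (Uq.gen q x) = Uq.counitGen x • w) (u : Uq q) :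
    w ∘ₗ tensorRep q u = Uq.counit q u • w := by
  obtain ⟨u, rfl⟩ := Uq.mk_surjective u
  induction u using FreeAlgebra.induction with
  | grade0 r => ext; simp [AlgHom.commutes, Module.algebraMap_end_apply]
  | grade1 x => exact (hw x).trans (by rw [← Uq.counit_gen (q := q) x]; rfl)
  | mul x y hx hy =>
    rw [map_mul, map_mul, map_mul, Module.End.mul_eq_comp, ← LinearMap.comp_assoc, hx,
      LinearMap.smul_comp, hy, smul_smul]
  | add x y hx hy => rw [map_add, map_add, map_add, LinearMap.comp_add, hx, hy, add_smul]

/-- The standard basis of `V 1`. -/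
abbrev e (i : Fin 2) : V 1 := Pi.single i 1

theorem opE_e0 : V.opE q 1 (e 0) = 0 := by
  ext i; fin_cases i <;> simp [V.opE_apply]

theorem opE_e1 : V.opE q 1 (e 1) = qInt q 1 • e 0 := by
  ext i; fin_cases i <;> simp [V.opE_apply]

theorem opF_e0 : V.opF q 1 (e 0) = qInt q 1 • e 1 := by
  ext i; fin_cases i <;> simp [V.opF_apply]

theorem opF_e1 : V.opF q 1 (e 1) = 0 := by
  ext i; fin_cases i <;> simp [V.opF_apply]

theorem opK_e0 : V.opK q 1 (e 0) = (q : ℂ) • e 0 := by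
  ext i; fin_cases i <;> simp [V.opK_apply]

theorem opK_e1 : V.opK q 1 (e 1) = (q : ℂ)⁻¹ • e 1 := by
  ext i; fin_cases i <;> norm_num [V.opK_apply]

theorem opKinv_e0 : V.opKinv q 1 (e 0) = (q : ℂ)⁻¹ • e 0 := by
  ext i; fin_cases i <;> norm_num [V.opKinv_apply]

theorem opKinv_e1 : V.opKinv q 1 (e 1) = (q : ℂ) • e 1 := by
  ext i; fin_cases i <;> simp [V.opKinv_apply]

theorem endTensor_tmul (f g : Module.End ℂ (V 1)) (v w : V 1) :
    Module.endTensorEndAlgHom (R := ℂ) (S := ℂ) (A := ℂ) (f ⊗ₜ[ℂ] g) (v ⊗ₜ[ℂ] w) =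
      f v ⊗ₜ[ℂ] g w := by
  rw [Module.endTensorEndAlgHom_apply]; rfl

/-- The action of the generators on pure tensors. -/
theorem tensorRep_E (v w : V 1) : tensorRep q (Uq.gen q .E) (v ⊗ₜ w) =
    V.opE q 1 v ⊗ₜ w + V.opK q 1 v ⊗ₜ V.opE q 1 w := by
  simp [tensorRep, Uq.comulGen, V.opGen, endTensor_tmul]

theorem tensorRep_F (v w : V 1) : tensorRep q (Uq.gen q .F) (v ⊗ₜ w) =
    V.opF q 1 v ⊗ₜ V.opKinv q 1 w + v ⊗ₜ V.opF q 1 w := by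
  simp [tensorRep, Uq.comulGen, V.opGen, endTensor_tmul]

theorem tensorRep_K (v w : V 1) : tensorRep q (Uq.gen q .K) (v ⊗ₜ w) =
    V.opK q 1 v ⊗ₜ V.opK q 1 w := by
  simp [tensorRep, Uq.comulGen, V.opGen, endTensor_tmul]

theorem tensorRep_Kinv (v w : V 1) : tensorRep q (Uq.gen q .Kinv) (v ⊗ₜ w) =
    V.opKinv q 1 v ⊗ₜ V.opKinv q 1 w := by
  simp [tensorRep, Uq.comulGen, V.opGen, endTensor_tmul]

theorem invariant (u : Uq q) :
    tensorRep q u (e 0 ⊗ₜ e 1 - (q : ℂ) • (e 1 ⊗ₜ e 0)) =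
      Uq.counit q u • (e 0 ⊗ₜ e 1 - (q : ℂ) • (e 1 ⊗ₜ e 0)) := by
  have hq : (q : ℂ) ≠ 0 := q.ne_zero
  apply tensorRep_invariant
  rintro (_ | _ | _ | _) <;>
    simp only [map_sub, map_smul, tensorRep_E, tensorRep_F, tensorRep_K, tensorRep_Kinv, opE_e0,
      opE_e1, opF_e0, opF_e1, opK_e0, opK_e1, opKinv_e0, opKinv_e1, Uq.counitGen,
      TensorProduct.zero_tmul, TensorProduct.tmul_zero, TensorProduct.tmul_smul,
      ← TensorProduct.smul_tmul', smul_smul, zero_smul, zero_add, add_zero, one_smul,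
      mul_inv_cancel₀ hq, inv_mul_cancel₀ hq] <;>
    module

theorem tensor_ext {f g : V 1 ⊗[ℂ] V 1 →ₗ[ℂ] ℂ}
    (h : ∀ i j, f (e i ⊗ₜ e j) = g (e i ⊗ₜ e j)) : f = g := by
  apply TensorProduct.ext
  apply LinearMap.pi_ext'
  intro i
  ext
  exact h _ _

theorem tensorFun_e (i j k l : Fin 2) :
    tensorFun (LinearMap.proj i) (LinearMap.proj k) (e j ⊗ₜ e l) =
      (if i = j then 1 else 0) * (if k = l then 1 else 0) := by
  simp [tensorFun, Pi.single_apply]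

/-- The invariant functional on the tensor square of the standard representation. -/
def coinv (q : ℂˣ) : V 1 ⊗[ℂ] V 1 →ₗ[ℂ] ℂ :=
  tensorFun (LinearMap.proj 0) (LinearMap.proj 1) -
    (q : ℂ) • tensorFun (LinearMap.proj 1) (LinearMap.proj 0)

theorem coinv_e (j l : Fin 2) : coinv q (e j ⊗ₜ e l) =
    (if 0 = j then 1 else 0) * (if 1 = l then 1 else 0) -
      (q : ℂ) * ((if 1 = j then 1 else 0) * (if 0 = l then 1 else 0)) := by
  rw [coinv, LinearMap.sub_apply, LinearMap.smul_apply, tensorFun_e, tensorFun_e, smul_eq_mul]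

theorem coinvariant (u : Uq q) : coinv q ∘ₗ tensorRep q u = Uq.counit q u • coinv q := by
  have hq : (q : ℂ) ≠ 0 := q.ne_zero
  apply tensorRep_coinvariant
  intro x
  apply tensor_ext
  intro i j
  cases x <;> fin_cases i <;> fin_cases j <;>
    simp [tensorRep_E, tensorRep_F, tensorRep_K, tensorRep_Kinv, opE_e0, opE_e1, opF_e0, opF_e1,
      opK_e0, opK_e1, opKinv_e0, opKinv_e1, Uq.counitGen, coinv, tensorFun_e,
      TensorProduct.tmul_smul, ← TensorProduct.smul_tmul', hq] <;>
    field_simp <;> simp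

/-- The relations coming from the invariant vector. -/
theorem row_rel (i k : Fin 2) (u : Uq q) :
    (stdCoeff q i 0 * stdCoeff q k 1) u - (q : ℂ) * (stdCoeff q i 1 * stdCoeff q k 0) u =
      Uq.counit q u * (tensorFun (LinearMap.proj i) (LinearMap.proj k)
        (e 0 ⊗ₜ e 1 - (q : ℂ) • (e 1 ⊗ₜ e 0))) := by
  rw [stdCoeff_mul, stdCoeff_mul, ← smul_eq_mul, ← smul_eq_mul, ← map_smul, ← map_smul, ← map_sub,
    ← map_smul, ← map_sub, invariant, map_smul]

/-- The relations coming from the invariant functional. -/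
theorem col_rel (j l : Fin 2) (u : Uq q) :
    (stdCoeff q 0 j * stdCoeff q 1 l) u - (q : ℂ) * (stdCoeff q 1 j * stdCoeff q 0 l) u =
      Uq.counit q u * coinv q (e j ⊗ₜ e l) := by
  rw [stdCoeff_mul, stdCoeff_mul]
  exact LinearMap.congr_fun (coinvariant u) (e j ⊗ₜ e l)

end Pairing

theorem entry_relations (q : ℂˣ) (u : Uq q) :
    (stdCoeff q 0 0 * stdCoeff q 0 1) u = (q : ℂ) * (stdCoeff q 0 1 * stdCoeff q 0 0) u ∧
    (stdCoeff q 0 0 * stdCoeff q 1 0) u = (q : ℂ) * (stdCoeff q 1 0 * stdCoeff q 0 0) u ∧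
    (stdCoeff q 0 1 * stdCoeff q 1 0) u = (stdCoeff q 1 0 * stdCoeff q 0 1) u ∧
    (stdCoeff q 0 1 * stdCoeff q 1 1) u = (q : ℂ) * (stdCoeff q 1 1 * stdCoeff q 0 1) u ∧
    (stdCoeff q 1 0 * stdCoeff q 1 1) u = (q : ℂ) * (stdCoeff q 1 1 * stdCoeff q 1 0) u ∧
    (stdCoeff q 0 0 * stdCoeff q 1 1) u - (stdCoeff q 1 1 * stdCoeff q 0 0) u =
      ((q : ℂ) - (q : ℂ)⁻¹) * (stdCoeff q 0 1 * stdCoeff q 1 0) u ∧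
    (stdCoeff q 0 0 * stdCoeff q 1 1) u - (q : ℂ) * (stdCoeff q 0 1 * stdCoeff q 1 0) u =
      Uq.counit q u := by
  have hq : (q : ℂ) ≠ 0 := q.ne_zero
  have r00 := Pairing.row_rel (q := q) 0 0 u
  have r01 := Pairing.row_rel (q := q) 0 1 u
  have r11 := Pairing.row_rel (q := q) 1 1 u
  have c00 := Pairing.col_rel (q := q) 0 0 u
  have c10 := Pairing.col_rel (q := q) 1 0 u
  have c01 := Pairing.col_rel (q := q) 0 1 u
  have c11 := Pairing.col_rel (q := q) 1 1 u
  simp only [map_sub, map_smul, Pairing.coinv_e, Pairing.tensorFun_e, smul_eq_mul, if_pos,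
    if_neg zero_ne_one, if_neg one_ne_zero, mul_zero, mul_one, sub_zero, zero_sub, mul_neg]
    at r00 r01 r11 c00 c10 c01 c11
  have bc : (stdCoeff q 0 1 * stdCoeff q 1 0) u = (stdCoeff q 1 0 * stdCoeff q 0 1) u := by
    apply mul_left_cancel₀ hq
    linear_combination c01 - r01
  refine ⟨by linear_combination r00, by linear_combination c00, bc, by linear_combination c11,
    by linear_combination r11, ?_, r01⟩
  field_simp
  linear_combination (q : ℂ) * r01 + c10

/-- The algebra homomorphism from `O_q(Mat₂)` to the dual of `U_q(sl₂)`, with the convolution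
product, that sends the generators to the matrix coefficients of the standard representation. -/
def matPairing (q : ℂˣ) : OqMat2 q →ₐ[ℂ] WithConv (Uq q →ₗ[ℂ] ℂ) :=
  OqMat2.lift (pairingGen q)
    (by ext u; exact (entry_relations q u).1)
    (by ext u; exact (entry_relations q u).2.1)
    (by ext u; exact (entry_relations q u).2.2.1)
    (by ext u; exact (entry_relations q u).2.2.2.1)
    (by ext u; exact (entry_relations q u).2.2.2.2.1)
    (by ext u; exact (entry_relations q u).2.2.2.2.2.1)

theorem matPairing_qdet (q : ℂˣ) : matPairing q (OqMat2.qdet q) = 1 := by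
  simp only [OqMat2.qdet, map_sub, map_mul, map_smul, matPairing, OqMat2.lift_gen]
  ext u
  exact (entry_relations q u).2.2.2.2.2.2

/-- The identification of `O_q(SL₂)` with an algebra of matrix coefficients: the algebra
homomorphism from `O_q(SL₂)` to the dual of `U_q(sl₂)`, with the convolution product, that sends the
generators `a, b, c, d` to the matrix coefficients of the standard representation `V 1`. -/
def pairing (q : ℂˣ) : OqSL2 q →ₐ[ℂ] WithConv (Uq q →ₗ[ℂ] ℂ) :=
  OqSL2.lift (matPairing q) (matPairing_qdet q)

/-- The span of the matrix coefficients of `V m`: the image of `V m ⊗ (V m)^*` in the dual of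
`U_q(sl₂)`. -/
def coeffSpace (q : ℂˣ) (m : ℕ) : Submodule ℂ (Module.Dual ℂ (Uq q)) :=
  Submodule.span ℂ {f | ∃ (φ : Module.Dual ℂ (V m)) (v : V m), f = matrixCoeff q m φ v}

/-- The dominance ordering on weights of `sl₂`: the difference is a nonnegative multiple of the
simple root, which is `2` when the fundamental weight is `1`. -/
def DominanceLE (m n : ℤ) : Prop := ∃ k : ℕ, n - m = 2 * k

/-- The Peter–Weyl filtration on `O_q(SL₂)`: the elements corresponding to sums of matrix
coefficients of the modules `V m` with `m ≤ n` in the dominance ordering. -/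
def peterWeyl (q : ℂˣ) (n : ℤ) : Submodule ℂ (OqSL2 q) :=
  (⨆ (m : ℕ) (_ : DominanceLE m n), coeffSpace q m).comap
    ((WithConv.linearEquiv ℂ (Uq q →ₗ[ℂ] ℂ)).toLinearMap ∘ₗ (pairing q).toLinearMap)

/-- The algebra `O_q(SL₂)[z]` of polynomials in a central variable `z`, with its bialgebra structure
in which `z` is grouplike. The element `f z ^ n` is `AddMonoidAlgebra.single n f`. -/
abbrev OqSL2z (q : ℂˣ) : Type := AddMonoidAlgebra (OqSL2 q) ℕ

/-- The graded subspace `⨁ₙ O_q(SL₂)_{≤ n} z ^ n` of `O_q(SL₂)[z]`. -/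
def rees (q : ℂˣ) : Submodule ℂ (OqSL2z q) where
  carrier := {p | ∀ n : ℕ, p.coeff n ∈ peterWeyl q n}
  zero_mem' n := by simp
  add_mem' hp hp' n := by simpa using add_mem (hp n) (hp' n)
  smul_mem' c p hp n := by simpa using (peterWeyl q n).smul_mem c (hp n)

/-! ### Sub-bialgebras -/

/-- A sub-bialgebra of a complex bialgebra `B`: a subalgebra with a coalgebra structure which is the
restriction of that of `B`. Both structure maps are determined by the subalgebra, since the map
`S ⊗ S → B ⊗ B` is injective. -/
structure SubBialgebra (B : Type*) [Ring B] [Bialgebra ℂ B] extends Subalgebra ℂ B where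
  coalgebra : Coalgebra ℂ toSubalgebra
  map_comul (x : toSubalgebra) :
    TensorProduct.map toSubalgebra.val.toLinearMap toSubalgebra.val.toLinearMap
      (coalgebra.comul x) = Coalgebra.comul (R := ℂ) (x : B)
  counit_coe (x : toSubalgebra) : coalgebra.counit x = Coalgebra.counit (R := ℂ) (x : B)

namespace SubBialgebra

variable {B : Type*} [Ring B] [Bialgebra ℂ B] (S : SubBialgebra B)

theorem comul_ext {s t : S.toSubalgebra ⊗[ℂ] S.toSubalgebra}
    (h : Algebra.TensorProduct.map S.toSubalgebra.val S.toSubalgebra.val s =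
      Algebra.TensorProduct.map S.toSubalgebra.val S.toSubalgebra.val t) : s = t :=
  TensorProduct.map_injective_of_flat_flat S.toSubalgebra.val.toLinearMap
    S.toSubalgebra.val.toLinearMap Subtype.val_injective Subtype.val_injective h

theorem map_comul' (x : S.toSubalgebra) :
    Algebra.TensorProduct.map S.toSubalgebra.val S.toSubalgebra.val (S.coalgebra.comul x) =
      Coalgebra.comul (R := ℂ) (x : B) := S.map_comul x

instance : Coalgebra ℂ S.toSubalgebra := S.coalgebra

instance : Bialgebra ℂ S.toSubalgebra :=
  Bialgebra.mk' ℂ S.toSubalgebra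
    (by rw [S.counit_coe]; simp)
    (by intro a b; rw [S.counit_coe, S.counit_coe, S.counit_coe]; simp)
    (by apply S.comul_ext; rw [S.map_comul']; simp)
    (by
      intro a b
      apply S.comul_ext
      rw [map_mul (Algebra.TensorProduct.map S.toSubalgebra.val S.toSubalgebra.val),
        S.map_comul', S.map_comul', S.map_comul']
      simp)

end SubBialgebra

end QuantumSL2
end

/-!
Send each generator `x` of `O_q(Mat₂)` to `x z`. This is a homomorphism of bialgebras into
`O_q(SL₂)[z]` which takes `D_q` to `z²`, and it remains to see that it maps the degree `n` part of
`O_q(Mat₂)` bijectively onto `O_q(SL₂)_{≤ n} zⁿ`. Pair both with `U_q(sl₂)`. The matrix coefficients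
of all the `𝒱ₘ` are linearly independent, since the Casimir element separates the `𝒱ₘ` and left and
right multiplication by `K` separate the pairs of weights. As `𝒱ₘ₊₁` embeds into `𝒱₁ ⊗ 𝒱ₘ`, the
coefficients of `𝒱ₘ` come from polynomials of degree `m` in `a, b, c, d`; as `D_q` pairs like `1`,
those of `𝒱ₙ`, `𝒱ₙ₋₂`, … all come from degree `n`. They span a space of dimension
`(n+1)² + (n-1)² + ⋯ = (n+3 choose 3)`, and there are only that many ordered monomials of degree
`n`, so the pairing is injective on the degree `n` part, with the expected image.
-/

noncomputable section

namespace QuantumSL2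

section LinearAlgebra

theorem linearIndependent_of_joint_eigenvectors {R M ι κ : Type*} [CommRing R] [IsDomain R]
    [AddCommGroup M] [Module R M] [Module.IsTorsionFree R M] (T : κ → Module.End R M)
    {μ : ι → κ → R} (hμ : Function.Injective μ) {v : ι → M} (hv : ∀ i, v i ≠ 0)
    (hT : ∀ i k, T k (v i) = μ i k • v i) : LinearIndependent R v := by
  classical
  refine linearIndependent_iff'.2 fun s ↦ ?_
  induction s using Finset.induction_on with
  | empty => simp
  | insert a s ha ih =>
    intro g hg
    have vanish_on_s : ∀ i ∈ s, g i = 0 := fun i hi ↦ by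
      obtain ⟨k, hk⟩ := Function.ne_iff.1 (hμ.ne (ne_of_mem_of_not_mem hi ha))
      have hsum : ∑ j ∈ s, (g j * (μ j k - μ a k)) • v j = 0 := by
        have := congrArg (T k - μ a k • LinearMap.id : Module.End R M) hg
        simpa [Finset.sum_insert ha, hT, smul_smul, Finset.smul_sum,
          ← Finset.sum_sub_distrib, mul_sub, sub_smul, mul_comm] using this
      exact (mul_eq_zero.1 (ih _ hsum i hi)).resolve_right (sub_ne_zero.2 hk)
    rw [Finset.sum_insert ha, Finset.sum_eq_zero fun i hi ↦ by rw [vanish_on_s i hi, zero_smul],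
      add_zero] at hg
    exact (Finset.forall_mem_insert _ _ _).2 ⟨(smul_eq_zero.1 hg).resolve_right (hv a), vanish_on_s⟩

variable {K M N : Type*} [DivisionRing K] [AddCommGroup M] [Module K M] [AddCommGroup N]
  [Module K N]

theorem map_eq_and_disjoint_ker_of_finrank_le (f : M →ₗ[K] N) {P : Submodule K M}
    {Q : Submodule K N} [FiniteDimensional K P] (hQ : Q ≤ P.map f)
    (hPQ : Module.finrank K P ≤ Module.finrank K Q) : P.map f = Q ∧ Disjoint P f.ker := by
  have map_eq : P.map f = Q :=
    (Submodule.eq_of_le_of_finrank_le hQ ((Submodule.finrank_map_le f P).trans hPQ)).symm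
  refine ⟨map_eq, ?_⟩
  have hrank : Module.finrank K (f.domRestrict P).range = Module.finrank K P := by
    rw [LinearMap.range_domRestrict]
    exact le_antisymm (Submodule.finrank_map_le f P) (map_eq ▸ hPQ)
  have hker : (f.domRestrict P).ker = ⊥ := Submodule.finrank_eq_zero.1 <| by
    have := (f.domRestrict P).finrank_range_add_finrank_ker
    omega
  rwa [LinearMap.ker_eq_bot, LinearMap.injective_domRestrict_iff] at hker

end LinearAlgebra

theorem sum_sq_eq_choose (n : ℕ) :
    ∑ m ∈ Finset.range (n + 1) with m % 2 = n % 2, (m + 1) ^ 2 = (n + 3).choose 3 := by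
  induction n using Nat.twoStepInduction with
  | zero => rfl
  | one => rfl
  | more n ih _ =>
    have hsplit : ({m ∈ Finset.range (n + 3) | m % 2 = (n + 2) % 2} : Finset ℕ) =
        insert (n + 2) {m ∈ Finset.range (n + 1) | m % 2 = n % 2} := by
      ext m
      simp only [Finset.mem_filter, Finset.mem_range, Finset.mem_insert]
      omega
    rw [hsplit, Finset.sum_insert (by simp), ih]
    have htriangle : (n + 3).choose 2 * 2 = (n + 3) * (n + 2) := by
      simpa using (Nat.add_one_mul_choose_eq (n + 2) 1).symm
    rw [Nat.choose_succ_succ' (n + 4) 2, Nat.choose_succ_succ' (n + 3) 2,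
      Nat.choose_succ_succ' (n + 3) 1, Nat.choose_one_right]
    linarith

namespace SubBialgebra

section Range

variable {A B : Type*} [Ring A] [Bialgebra ℂ A] [Ring B] [Bialgebra ℂ B]
  (f : A →ₐc[ℂ] B) (hf : Function.Injective f)

/-- The comultiplication and counit on the range of an injective bialgebra homomorphism, transported
from its source. -/
@[reducible]
def rangeCoalgebraStruct : CoalgebraStruct ℂ (f : A →ₐ[ℂ] B).range :=
  let e := (AlgEquiv.ofInjective (f : A →ₐ[ℂ] B) hf).toLinearEquiv
  { comul := TensorProduct.map e.toLinearMap e.toLinearMap ∘ₗ Coalgebra.comul ∘ₗ e.symm.toLinearMap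
    counit := Coalgebra.counit ∘ₗ e.symm.toLinearMap }

/-- The isomorphism of coalgebras of an injective bialgebra homomorphism onto its range. -/
def rangeCoalgEquiv :
    letI := rangeCoalgebraStruct f hf
    A ≃ₗc[ℂ] (f : A →ₐ[ℂ] B).range :=
  letI := rangeCoalgebraStruct f hf
  let e := (AlgEquiv.ofInjective (f : A →ₐ[ℂ] B) hf).toLinearEquiv
  { e with
    counit_comp := LinearMap.ext fun x ↦ congrArg Coalgebra.counit (e.symm_apply_apply x)
    map_comp_comul := LinearMap.ext fun x ↦ congrArg
      (TensorProduct.map e.toLinearMap e.toLinearMap ∘ₗ Coalgebra.comul)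
      (e.symm_apply_apply x).symm }

/-- The range of an injective bialgebra homomorphism, as a sub-bialgebra. -/
def range : SubBialgebra B where
  toSubalgebra := (f : A →ₐ[ℂ] B).range
  coalgebra :=
    letI := rangeCoalgebraStruct f hf
    (rangeCoalgEquiv f hf).toCoalgebra
  map_comul x := by
    let e := AlgEquiv.ofInjective (f : A →ₐ[ℂ] B) hf
    obtain ⟨a, rfl⟩ := e.surjective x
    change TensorProduct.map _ _ (TensorProduct.map e.toLinearMap e.toLinearMap
      (Coalgebra.comul (e.symm (e a)))) = Coalgebra.comul (f a)
    rw [e.symm_apply_apply, TensorProduct.map_map]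
    exact CoalgHomClass.map_comp_comul_apply f a
  counit_coe x := by
    let e := AlgEquiv.ofInjective (f : A →ₐ[ℂ] B) hf
    obtain ⟨a, rfl⟩ := e.surjective x
    change Coalgebra.counit (e.symm (e a)) = Coalgebra.counit (f a)
    rw [e.symm_apply_apply, CoalgHomClass.counit_comp_apply]

/-- The isomorphism of an injective bialgebra homomorphism onto its range. -/
def equivRange : A ≃ₐc[ℂ] (range f hf).toSubalgebra :=
  { AlgEquiv.ofInjective (f : A →ₐ[ℂ] B) hf, rangeCoalgEquiv f hf with }

end Range
end SubBialgebra

section QInteger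

variable {q : ℂˣ}

theorem qInt_zero : qInt q 0 = 0 := by simp [qInt]

theorem qInt_add (r s : ℤ) :
    qInt q (r + s) = (q : ℂ) ^ s * qInt q r + (q : ℂ) ^ (-r) * qInt q s := by
  simp only [qInt, neg_add, zpow_add₀ q.ne_zero]
  ring

/-- The scalar `(qⁿ + q⁻ⁿ) / (q - q⁻¹)²`, by which the quantum Casimir element acts on the
irreducible module of dimension `n`. -/
def casimirValue (q : ℂˣ) (n : ℤ) : ℂ :=
  ((q : ℂ) ^ n + (q : ℂ) ^ (-n)) / ((q : ℂ) - (q : ℂ)⁻¹) ^ 2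

theorem qInt_mul_qInt (r s : ℤ) :
    qInt q r * qInt q s = casimirValue q (r + s) - casimirValue q (r - s) := by
  simp only [qInt, casimirValue, div_mul_div_comm, ← sub_div, ← pow_two, sub_eq_add_neg r s,
    neg_add, neg_neg, zpow_add₀ q.ne_zero]
  ring

theorem zpow_inj_of_not_isOfFinOrder (hq : ¬IsOfFinOrder q) {r s : ℤ} :
    (q : ℂ) ^ r = (q : ℂ) ^ s ↔ r = s := by
  rw [← (injective_zpow_iff_not_isOfFinOrder.2 hq).eq_iff, Units.ext_iff,
    Units.val_zpow_eq_zpow_val, Units.val_zpow_eq_zpow_val]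

theorem sub_inv_ne_zero (hq : ¬IsOfFinOrder q) : (q : ℂ) - (q : ℂ)⁻¹ ≠ 0 := by
  have h : (q : ℂ) ^ (1 : ℤ) ≠ (q : ℂ) ^ (-1 : ℤ) :=
    (zpow_inj_of_not_isOfFinOrder hq).not.2 (by decide)
  rwa [zpow_one, zpow_neg_one, ← sub_ne_zero] at h

theorem qInt_ne_zero (hq : ¬IsOfFinOrder q) {n : ℤ} (hn : n ≠ 0) : qInt q n ≠ 0 :=
  div_ne_zero (sub_ne_zero.2 fun h ↦ hn (by
    have := (zpow_inj_of_not_isOfFinOrder hq).1 h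
    lia)) (sub_inv_ne_zero hq)

theorem casimirValue_eq_iff (hq : ¬IsOfFinOrder q) {r s : ℤ} :
    casimirValue q r = casimirValue q s ↔ r = s ∨ r = -s := by
  refine ⟨fun h ↦ ?_, by rintro (rfl | rfl) <;> simp [casimirValue, add_comm]⟩
  have hsum := (div_left_inj' (pow_ne_zero 2 (sub_inv_ne_zero hq))).1 h
  have hfactor : ((q : ℂ) ^ r - (q : ℂ) ^ s) * ((q : ℂ) ^ r - (q : ℂ) ^ (-s)) = 0 := by
    have cancel (t : ℤ) : (q : ℂ) ^ t * (q : ℂ) ^ (-t) = 1 := by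
      rw [← zpow_add₀ q.ne_zero, add_neg_cancel, zpow_zero]
    linear_combination (q : ℂ) ^ r * hsum - cancel r + cancel s
  simpa only [mul_eq_zero, sub_eq_zero, zpow_inj_of_not_isOfFinOrder hq] using hfactor

end QInteger

namespace Uq

/-- The quantum Casimir element `FE + (qK + q⁻¹K⁻¹) / (q - q⁻¹)²`. -/
def casimir (q : ℂˣ) : Uq q :=
  F q * E q + (((q : ℂ) - (q : ℂ)⁻¹) ^ 2)⁻¹ • ((q : ℂ) • K q + (q : ℂ)⁻¹ • Kinv q)

end Uq

namespace V

variable {q : ℂˣ} {m : ℕ}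

theorem opF_opE_apply (f : V m) (i : Fin (m + 1)) :
    opF q m (opE q m f) i = qInt q i * qInt q (m - i + 1) * f i := by
  obtain ⟨i, hi⟩ := i
  rcases i with _ | i
  · simp [opF_apply, qInt_zero]
  · have hm : (m : ℤ) - ((i + 1 : ℕ) : ℤ) + 1 = m - i := by push_cast; ring
    rw [hm]
    simp [opF_apply, opE_apply, Nat.lt_of_succ_lt_succ hi, mul_assoc]

theorem rep_casimir : rep q m (Uq.casimir q) = casimirValue q (m + 1) • 1 := by
  refine LinearMap.ext fun f ↦ funext fun i ↦ ?_
  have hFE := qInt_mul_qInt (q := q) i (m - i + 1)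
  have hK : casimirValue q (i - (m - i + 1)) = (((q : ℂ) - (q : ℂ)⁻¹) ^ 2)⁻¹ *
      ((q : ℂ) * (q : ℂ) ^ ((m : ℤ) - 2 * i) + (q : ℂ)⁻¹ * (q : ℂ) ^ (-((m : ℤ) - 2 * i))) := by
    rw [casimirValue, div_eq_inv_mul, add_comm ((q : ℂ) ^ _), ← zpow_one_add₀ q.ne_zero,
      ← zpow_neg_one (q : ℂ), ← zpow_add₀ q.ne_zero]
    ring_nf
  simp only [Uq.casimir, map_add, map_mul, map_smul, rep_gen, opGen, LinearMap.add_apply,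
    LinearMap.smul_apply, Module.End.mul_apply, Module.End.one_apply, Pi.add_apply, Pi.smul_apply,
    smul_eq_mul, opF_opE_apply, opK_apply, opKinv_apply]
  rw [show (i + (m - i + 1) : ℤ) = m + 1 by ring] at hFE
  linear_combination f i * (hFE - hK)

theorem opK_single (j : Fin (m + 1)) :
    opK q m (Pi.single j 1) = (q : ℂ) ^ ((m : ℤ) - 2 * j) • Pi.single j 1 := by
  ext i
  rcases eq_or_ne i j with rfl | hij <;> simp [opK_apply, *]

theorem opE_single (j : Fin m) :
    opE q m (Pi.single j.succ 1) = qInt q (m - j) • Pi.single j.castSucc 1 := by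
  ext i
  simp only [opE_apply, Pi.smul_apply, Pi.single_apply, Fin.ext_iff, Fin.val_succ,
    Fin.val_castSucc, Nat.add_right_cancel_iff]
  have := j.isLt
  split_ifs <;> simp_all

theorem opF_single (j : Fin m) :
    opF q m (Pi.single j.castSucc 1) = qInt q (j + 1) • Pi.single j.succ 1 := by
  ext i
  simp only [opF_apply, Pi.smul_apply, Pi.single_apply, Fin.ext_iff, Fin.val_succ,
    Fin.val_castSucc]
  split_ifs <;> (simp_all; try lia)

theorem exists_opE_pow_single (hq : ¬IsOfFinOrder q) (j : Fin (m + 1)) :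
    ∃ c : ℂ, c ≠ 0 ∧ (opE q m ^ (j : ℕ)) (Pi.single j 1) = c • Pi.single 0 1 := by
  induction j using Fin.induction with
  | zero => exact ⟨1, one_ne_zero, by simp⟩
  | succ j ih =>
    obtain ⟨c, hc, h⟩ := ih
    have hj := j.isLt
    refine ⟨qInt q (m - j) * c, mul_ne_zero (qInt_ne_zero hq (by lia)) hc, ?_⟩
    rw [Fin.val_succ, pow_succ, Module.End.mul_apply, opE_single, map_smul, ← Fin.val_castSucc, h,
      smul_smul, Fin.val_castSucc]

theorem exists_opF_pow_single (hq : ¬IsOfFinOrder q) (i : Fin (m + 1)) :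
    ∃ c : ℂ, c ≠ 0 ∧ (opF q m ^ (i : ℕ)) (Pi.single 0 1) = c • Pi.single i 1 := by
  induction i using Fin.induction with
  | zero => exact ⟨1, one_ne_zero, by simp⟩
  | succ i ih =>
    obtain ⟨c, hc, h⟩ := ih
    refine ⟨c * qInt q (i + 1), mul_ne_zero hc (qInt_ne_zero hq (by lia)), ?_⟩
    rw [Fin.val_succ, pow_succ', Module.End.mul_apply, ← Fin.val_castSucc, h,
      map_smul, opF_single, smul_smul, Fin.val_castSucc]

end V

/-- A matrix coefficient of `V m` in its standard basis. -/
def basisCoeff (q : ℂˣ) (m : ℕ) (i j : Fin (m + 1)) : Module.Dual ℂ (Uq q) :=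
  matrixCoeff q m (LinearMap.proj i) (Pi.single j 1)

section BasisCoeff

variable {q : ℂˣ}

theorem matrixCoeff_eq_sum {m : ℕ} (φ : Module.Dual ℂ (V m)) (v : V m) :
    matrixCoeff q m φ v = ∑ i, ∑ j, (φ (Pi.single i 1) * v j) • basisCoeff q m i j := by
  ext u
  have expand {W : Type} [AddCommGroup W] [Module ℂ W] (f : V m →ₗ[ℂ] W) (w : V m) :
      f w = ∑ i, w i • f (Pi.single i 1) := by
    conv_lhs => rw [pi_eq_sum_univ' w, map_sum]
    simp only [map_smul]
  rw [matrixCoeff_apply, expand φ, expand (V.rep q m u) v]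
  simp [basisCoeff, Finset.mul_sum, mul_comm, mul_assoc, mul_left_comm]

theorem span_basisCoeff (m : ℕ) :
    Submodule.span ℂ (Set.range fun ij : Fin (m + 1) × Fin (m + 1) ↦ basisCoeff q m ij.1 ij.2) =
      coeffSpace q m := by
  apply le_antisymm <;> refine Submodule.span_le.2 ?_
  · rintro _ ⟨ij, rfl⟩
    exact Submodule.subset_span ⟨_, _, rfl⟩
  · rintro _ ⟨φ, v, rfl⟩
    rw [SetLike.mem_coe, matrixCoeff_eq_sum]
    exact sum_mem fun i _ ↦ sum_mem fun j _ ↦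
      Submodule.smul_mem _ _ (Submodule.subset_span ⟨(i, j), rfl⟩)

theorem basisCoeff_ne_zero (hq : ¬IsOfFinOrder q) {m : ℕ} (i j : Fin (m + 1)) :
    basisCoeff q m i j ≠ 0 := by
  obtain ⟨c, hc, hE⟩ := V.exists_opE_pow_single hq j
  obtain ⟨c', hc', hF⟩ := V.exists_opF_pow_single hq i
  intro h
  have := LinearMap.congr_fun h (Uq.F q ^ (i : ℕ) * Uq.E q ^ (j : ℕ))
  simp [basisCoeff, V.opGen, hE, hF, hc, hc'] at this

theorem linearIndependent_basisCoeff (hq : ¬IsOfFinOrder q) :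
    LinearIndependent ℂ fun x : Σ m : ℕ, Fin (m + 1) × Fin (m + 1) ↦
      basisCoeff q x.1 x.2.1 x.2.2 := by
  refine linearIndependent_of_joint_eigenvectors
    (T := ![(LinearMap.mulLeft ℂ (Uq.casimir q)).dualMap, (LinearMap.mulLeft ℂ (Uq.K q)).dualMap,
      (LinearMap.mulRight ℂ (Uq.K q)).dualMap])
    (μ := fun x ↦ ![casimirValue q (x.1 + 1), (q : ℂ) ^ ((x.1 : ℤ) - 2 * x.2.1),
      (q : ℂ) ^ ((x.1 : ℤ) - 2 * x.2.2)]) ?_ (fun x ↦ basisCoeff_ne_zero hq _ _) ?_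
  · rintro ⟨m, i, j⟩ ⟨n, k, l⟩ h
    have hmn := (casimirValue_eq_iff hq).1 (congrFun h 0)
    have hik := (zpow_inj_of_not_isOfFinOrder hq).1 (congrFun h 1)
    have hjl := (zpow_inj_of_not_isOfFinOrder hq).1 (congrFun h 2)
    dsimp only at hmn hik hjl
    obtain rfl : m = n := by lia
    obtain rfl : i = k := Fin.ext (by lia)
    obtain rfl : j = l := Fin.ext (by lia)
    rfl
  · rintro ⟨m, i, j⟩ k
    ext u
    fin_cases k
    · simp [basisCoeff, V.rep_casimir]
    · simp [basisCoeff, V.opGen, V.opK_apply]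
    · simp [basisCoeff, V.opGen, V.opK_single]

end BasisCoeff

section TensorRep

variable {R H M N : Type*} [CommRing R] [Ring H] [AddCommGroup M] [Module R M] [AddCommGroup N]
  [Module R N]

/-- The functional `h ↦ φ (h v)` of a representation, as an element of the convolution algebra. -/
def repCoeff [Algebra R H] (ρ : H →ₐ[R] Module.End R M) (φ : Module.Dual R M) (v : M) :
    WithConv (H →ₗ[R] R) :=
  .toConv (φ ∘ₗ LinearMap.applyₗ v ∘ₗ ρ.toLinearMap)

theorem endTensorEndAlgHom_tmul_tmul (f : Module.End R M) (g : Module.End R N) (v : M) (w : N) :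
    Module.endTensorEndAlgHom (R := R) (S := R) (A := R) (f ⊗ₜ[R] g) (v ⊗ₜ[R] w) =
      f v ⊗ₜ[R] g w := rfl

variable [Bialgebra R H] (ρ : H →ₐ[R] Module.End R M) (σ : H →ₐ[R] Module.End R N)

/-- The tensor product of two representations of a bialgebra. -/
def tensorRep : H →ₐ[R] Module.End R (M ⊗[R] N) :=
  Module.endTensorEndAlgHom.comp
    ((Algebra.TensorProduct.map ρ σ).comp (Bialgebra.comulAlgHom R H))

theorem repCoeff_mul_repCoeff (φ : Module.Dual R M) (ψ : Module.Dual R N) (v : M) (w : N) :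
    repCoeff ρ φ v * repCoeff σ ψ w =
      repCoeff (tensorRep ρ σ) (TensorProduct.dualDistrib R M N (φ ⊗ₜ ψ)) (v ⊗ₜ w) := by
  have h : LinearMap.mul' R R ∘ₗ TensorProduct.map (repCoeff ρ φ v).ofConv (repCoeff σ ψ w).ofConv =
      TensorProduct.dualDistrib R M N (φ ⊗ₜ ψ) ∘ₗ LinearMap.applyₗ (v ⊗ₜ[R] w) ∘ₗ
        (Module.endTensorEndAlgHom.comp (Algebra.TensorProduct.map ρ σ)).toLinearMap := by
    ext x y
    rfl
  ext u
  exact LinearMap.congr_fun h (Coalgebra.comul u)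

end TensorRep

section Intertwining

variable {q : ℂˣ} {M N : Type*} [AddCommGroup M] [Module ℂ M] [AddCommGroup N] [Module ℂ N]

theorem Uq.intertwines_of_gen {ρ : Uq q →ₐ[ℂ] Module.End ℂ M} {σ : Uq q →ₐ[ℂ] Module.End ℂ N}
    {f : M →ₗ[ℂ] N} (hf : ∀ x v, f (ρ (gen q x) v) = σ (gen q x) (f v)) (u : Uq q) (v : M) :
    f (ρ u v) = σ u (f v) := by
  obtain ⟨u, rfl⟩ := Uq.mk_surjective u
  induction u using FreeAlgebra.induction generalizing v with
  | grade0 r => simp [AlgHom.commutes, Module.algebraMap_end_apply]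
  | grade1 x => exact hf x v
  | mul x y hx hy => simp [hx, hy]
  | add x y hx hy => simp [hx, hy]

end Intertwining

namespace V

variable {q : ℂˣ} {m : ℕ}

/-- The `e 0`-component of the embedding of `V (m + 1)` into `V 1 ⊗ V m`. -/
def lower (m : ℕ) : V (m + 1) →ₗ[ℂ] V m where
  toFun f k := f k.castSucc
  map_add' _ _ := rfl
  map_smul' _ _ := rfl

/-- The `e 1`-component of the embedding of `V (m + 1)` into `V 1 ⊗ V m`. -/
def upper (q : ℂˣ) (m : ℕ) : V (m + 1) →ₗ[ℂ] V m where
  toFun f k := (q : ℂ) ^ ((k : ℤ) - m) * f k.succ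
  map_add' f g := by ext; simp [mul_add]
  map_smul' c f := by ext; simp [mul_left_comm]

theorem lower_apply (f : V (m + 1)) (k : Fin (m + 1)) : lower m f k = f k.castSucc := rfl

theorem upper_apply (f : V (m + 1)) (k : Fin (m + 1)) :
    upper q m f k = (q : ℂ) ^ ((k : ℤ) - m) * f k.succ := rfl

theorem lower_opE (f : V (m + 1)) :
    lower m (opE q (m + 1) f) = (q : ℂ) • opE q m (lower m f) + qInt q 1 • upper q m f := by
  ext k
  have hk : qInt q ((m + 1 : ℕ) - k) =
      (q : ℂ) * qInt q (m - k) + (q : ℂ) ^ ((k : ℤ) - m) * qInt q 1 := by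
    have := qInt_add (q := q) (m - k) 1
    rwa [zpow_one, neg_sub, sub_add_eq_add_sub, ← Nat.cast_succ] at this
  have hE : opE q m (lower m f) k = qInt q (m - k) * f k.succ := by
    rcases (Nat.lt_succ_iff.1 k.isLt).lt_or_eq with h | h
    · simp [opE_apply, h, lower_apply, Fin.succ]
    · simp [opE_apply, h, qInt_zero]
  have hE' : lower m (opE q (m + 1) f) k = qInt q ((m + 1 : ℕ) - k) * f k.succ := dif_pos k.isLt
  rw [hE', hk, Pi.add_apply, Pi.smul_apply, Pi.smul_apply, hE, upper_apply, smul_eq_mul,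
    smul_eq_mul]
  ring

theorem upper_opE (f : V (m + 1)) :
    upper q m (opE q (m + 1) f) = (q : ℂ)⁻¹ • opE q m (upper q m f) := by
  ext k
  by_cases h : (k : ℕ) < m
  · simp only [upper_apply, opE_apply, h, Fin.val_succ, Nat.cast_succ, Pi.smul_apply, smul_eq_mul,
      dif_pos, Nat.add_lt_add_iff_right, add_sub_add_right_eq_sub]
    simp only [add_sub_right_comm _ (1 : ℤ), zpow_add_one₀ q.ne_zero, Fin.succ_mk]
    field_simp
  · simp [upper_apply, opE_apply, h]

theorem lower_opF (f : V (m + 1)) : lower m (opF q (m + 1) f) = opF q m (lower m f) := rfl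

theorem upper_opF (f : V (m + 1)) :
    upper q m (opF q (m + 1) f) = qInt q 1 • opKinv q m (lower m f) + opF q m (upper q m f) := by
  ext k
  have hk : (q : ℂ) ^ ((k : ℤ) - m) * qInt q ((k + 1 : ℕ)) =
      qInt q 1 * (q : ℂ) ^ (-((m : ℤ) - 2 * k)) + (q : ℂ) ^ ((k : ℤ) - 1 - m) * qInt q k := by
    rw [Nat.cast_succ, add_comm (k : ℤ), qInt_add]
    simp only [sub_eq_add_neg, neg_add, neg_neg, two_mul, zpow_add₀ q.ne_zero]
    ring
  have hF : opF q m (upper q m f) k = (q : ℂ) ^ ((k : ℤ) - 1 - m) * qInt q k * f k.castSucc := by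
    obtain ⟨_ | k, hk⟩ := k
    · simp [opF_apply, qInt_zero]
    · simp [opF_apply, upper_apply]
      ring
  have hF' : opF q (m + 1) f k.succ = qInt q (k + 1 : ℕ) * f k.castSucc := by
    rw [opF_apply, if_pos (by simp)]
    rfl
  rw [upper_apply, hF', ← mul_assoc, hk, Pi.add_apply, hF, Pi.smul_apply, opKinv_apply, lower_apply,
    smul_eq_mul]
  ring

theorem lower_opK (f : V (m + 1)) :
    lower m (opK q (m + 1) f) = (q : ℂ) • opK q m (lower m f) := by
  ext k
  have hk : ((m + 1 : ℕ) : ℤ) - 2 * k = 1 + (m - 2 * k) := by push_cast; ring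
  simp only [lower_apply, opK_apply, Fin.val_castSucc, hk, zpow_one_add₀ q.ne_zero, Pi.smul_apply,
    smul_eq_mul]
  ring

theorem upper_opK (f : V (m + 1)) :
    upper q m (opK q (m + 1) f) = (q : ℂ)⁻¹ • opK q m (upper q m f) := by
  ext k
  have hk : ((m + 1 : ℕ) : ℤ) - 2 * (k + 1 : ℕ) = -1 + (m - 2 * k) := by push_cast; ring
  simp only [upper_apply, opK_apply, Fin.val_succ, hk, zpow_add₀ q.ne_zero, zpow_neg_one,
    Pi.smul_apply, smul_eq_mul]
  ring

theorem lower_opKinv (f : V (m + 1)) :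
    lower m (opKinv q (m + 1) f) = (q : ℂ)⁻¹ • opKinv q m (lower m f) := by
  ext k
  have hk : -(((m + 1 : ℕ) : ℤ) - 2 * k) = -1 + -((m : ℤ) - 2 * k) := by push_cast; ring
  simp only [lower_apply, opKinv_apply, Fin.val_castSucc, hk, zpow_add₀ q.ne_zero, zpow_neg_one,
    Pi.smul_apply, smul_eq_mul]
  ring

theorem upper_opKinv (f : V (m + 1)) :
    upper q m (opKinv q (m + 1) f) = (q : ℂ) • opKinv q m (upper q m f) := by
  ext k
  have hk : -(((m + 1 : ℕ) : ℤ) - 2 * (k + 1 : ℕ)) = 1 + -((m : ℤ) - 2 * k) := by push_cast; ring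
  simp only [upper_apply, opKinv_apply, Fin.val_succ, hk, zpow_one_add₀ q.ne_zero, Pi.smul_apply,
    smul_eq_mul]
  ring

open Pairing in
/-- The embedding of `V (m + 1)` into `V 1 ⊗ V m` as a submodule. -/
def embed (q : ℂˣ) (m : ℕ) : V (m + 1) →ₗ[ℂ] V 1 ⊗[ℂ] V m :=
  TensorProduct.mk ℂ (V 1) (V m) (e 0) ∘ₗ lower m +
    TensorProduct.mk ℂ (V 1) (V m) (e 1) ∘ₗ upper q m

theorem embed_apply (f : V (m + 1)) :
    embed q m f = Pairing.e 0 ⊗ₜ lower m f + Pairing.e 1 ⊗ₜ upper q m f := rfl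

open Pairing in
theorem embed_rep (u : Uq q) (f : V (m + 1)) :
    embed q m (rep q (m + 1) u f) = tensorRep (rep q 1) (rep q m) u (embed q m f) := by
  refine Uq.intertwines_of_gen (fun x f ↦ ?_) u f
  have hcomul : Bialgebra.comulAlgHom ℂ (Uq q) (Uq.gen q x) = Uq.comulGen q x := Uq.comul_gen x
  rw [tensorRep, AlgHom.comp_apply, AlgHom.comp_apply, hcomul]
  cases x <;>
    simp [embed_apply, opGen, Uq.comulGen, endTensorEndAlgHom_tmul_tmul, lower_opE, upper_opE,
      lower_opF, upper_opF, lower_opK, upper_opK, lower_opKinv, upper_opKinv, opE_e0, opE_e1,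
      opF_e0, opF_e1, opK_e0, opK_e1, opKinv_e0, opKinv_e1, TensorProduct.tmul_add,
      TensorProduct.tmul_smul, ← TensorProduct.smul_tmul'] <;> abel

end V

section Recursion

variable {q : ℂˣ} {m : ℕ}

theorem toConv_matrixCoeff (φ : Module.Dual ℂ (V m)) (v : V m) :
    .toConv (matrixCoeff q m φ v) = repCoeff (V.rep q m) φ v := rfl

theorem matrixCoeff_dualDistrib_comp_embed (i : Fin 2) (ψ : Module.Dual ℂ (V m)) (v : V (m + 1)) :
    .toConv (matrixCoeff q (m + 1)
        (TensorProduct.dualDistrib ℂ (V 1) (V m) (LinearMap.proj i ⊗ₜ ψ) ∘ₗ V.embed q m) v) =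
      stdCoeff q i 0 * .toConv (matrixCoeff q m ψ (V.lower m v)) +
        stdCoeff q i 1 * .toConv (matrixCoeff q m ψ (V.upper q m v)) := by
  simp only [stdCoeff, toConv_matrixCoeff, repCoeff_mul_repCoeff]
  ext u
  simp only [repCoeff, WithConv.ofConv_toConv, WithConv.ofConv_add, LinearMap.add_apply,
    LinearMap.comp_apply, LinearMap.applyₗ_apply_apply, AlgHom.toLinearMap_apply]
  rw [V.embed_rep, V.embed_apply, map_add, map_add]

theorem matrixCoeff_proj_castSucc (i : Fin (m + 1)) (v : V (m + 1)) :
    .toConv (matrixCoeff q (m + 1) (LinearMap.proj i.castSucc) v) =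
      stdCoeff q 0 0 * .toConv (matrixCoeff q m (LinearMap.proj i) (V.lower m v)) +
        stdCoeff q 0 1 * .toConv (matrixCoeff q m (LinearMap.proj i) (V.upper q m v)) := by
  rw [← matrixCoeff_dualDistrib_comp_embed]
  congr 2
  ext v
  simp [V.embed_apply, V.lower_apply]

theorem matrixCoeff_proj_last (v : V (m + 1)) :
    .toConv (matrixCoeff q (m + 1) (LinearMap.proj (Fin.last (m + 1))) v) =
      stdCoeff q 1 0 * .toConv (matrixCoeff q m (LinearMap.proj (Fin.last m)) (V.lower m v)) +
        stdCoeff q 1 1 *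
          .toConv (matrixCoeff q m (LinearMap.proj (Fin.last m)) (V.upper q m v)) := by
  rw [← matrixCoeff_dualDistrib_comp_embed]
  congr 2
  ext v
  simp [V.embed_apply, V.upper_apply]

end Recursion

namespace OqMat2

variable {q : ℂˣ} {n : ℕ}

/-- The span of the products of `n` generators: the degree `n` part of `O_q(Mat₂)`. -/
def degreePart (q : ℂˣ) (n : ℕ) : Submodule ℂ (OqMat2 q) :=
  Submodule.span ℂ (Set.range (gen q)) ^ n

/-- The ordered monomial `bʲ cᵏ aⁱ dˡ`. In this order the commutator `(q - q⁻¹) b c` of `a` and `d`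
needs no further reordering. -/
def orderedMonomial (q : ℂˣ) (s : Fin 4 →₀ ℕ) : OqMat2 q :=
  b q ^ s 0 * (c q ^ s 1 * (a q ^ s 2 * d q ^ s 3))

/-- The span of the ordered monomials of degree `n`. -/
def orderedSpan (q : ℂˣ) (n : ℕ) : Submodule ℂ (OqMat2 q) :=
  Submodule.span ℂ (orderedMonomial q '' (Finset.univ.finsuppAntidiag n : Finset (Fin 4 →₀ ℕ)))

theorem monomial_mem_orderedSpan (j k i l : ℕ) :
    b q ^ j * (c q ^ k * (a q ^ i * d q ^ l)) ∈ orderedSpan q (j + k + i + l) :=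
  Submodule.subset_span ⟨Finsupp.equivFunOnFinite.symm ![j, k, i, l],
    by simp [Finset.mem_finsuppAntidiag, Fin.sum_univ_four], rfl⟩

theorem mul_mem_orderedSpan_of_forall_monomial {x y : OqMat2 q}
    (hx : ∀ j k i l, x * (b q ^ j * (c q ^ k * (a q ^ i * d q ^ l))) ∈
      orderedSpan q (j + k + i + l + 1)) (hy : y ∈ orderedSpan q n) :
    x * y ∈ orderedSpan q (n + 1) := by
  have h : orderedSpan q n ≤ (orderedSpan q (n + 1)).comap (LinearMap.mulLeft ℂ x) := by
    refine Submodule.span_le.2 ?_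
    rintro _ ⟨s, hs, rfl⟩
    obtain ⟨hs, -⟩ := Finset.mem_finsuppAntidiag.1 hs
    rw [Fin.sum_univ_four] at hs
    exact hs ▸ hx (s 0) (s 1) (s 2) (s 3)
  exact h hy

theorem b_mul_mem_orderedSpan {y : OqMat2 q} (hy : y ∈ orderedSpan q n) :
    b q * y ∈ orderedSpan q (n + 1) := by
  refine mul_mem_orderedSpan_of_forall_monomial (fun j k i l ↦ ?_) hy
  rw [← mul_assoc, ← pow_succ']
  convert monomial_mem_orderedSpan (j + 1) k i l using 2
  ring

theorem c_mul_mem_orderedSpan {y : OqMat2 q} (hy : y ∈ orderedSpan q n) :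
    c q * y ∈ orderedSpan q (n + 1) := by
  refine mul_mem_orderedSpan_of_forall_monomial (fun j k i l ↦ ?_) hy
  induction j with
  | zero =>
    rw [pow_zero, one_mul, ← mul_assoc, ← pow_succ', ← one_mul (_ * _), ← pow_zero (b q)]
    convert monomial_mem_orderedSpan 0 (k + 1) i l using 2
    ring
  | succ j ih =>
    rw [pow_succ', mul_assoc, ← mul_assoc, c_mul_b, mul_assoc]
    convert b_mul_mem_orderedSpan ih using 2
    ring

theorem a_mul_mem_orderedSpan {y : OqMat2 q} (hy : y ∈ orderedSpan q n) :
    a q * y ∈ orderedSpan q (n + 1) := by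
  refine mul_mem_orderedSpan_of_forall_monomial (fun j k i l ↦ ?_) hy
  induction j with
  | zero =>
    rw [pow_zero, one_mul]
    induction k with
    | zero =>
      have := monomial_mem_orderedSpan (q := q) 0 0 (i + 1) l
      simpa only [pow_zero, one_mul, pow_succ', mul_assoc, zero_add, add_right_comm] using this
    | succ k ih =>
      rw [pow_succ', mul_assoc, ← mul_assoc, a_mul_c, smul_mul_assoc, mul_assoc]
      convert Submodule.smul_mem _ _ (c_mul_mem_orderedSpan ih) using 2
      ring
  | succ j ih =>
    rw [pow_succ', mul_assoc, ← mul_assoc, a_mul_b, smul_mul_assoc, mul_assoc]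
    convert Submodule.smul_mem _ _ (b_mul_mem_orderedSpan ih) using 2
    ring

theorem d_mul_b : d q * b q = (q : ℂ)⁻¹ • (b q * d q) := by
  rw [b_mul_d, inv_smul_smul₀ q.ne_zero]

theorem d_mul_c : d q * c q = (q : ℂ)⁻¹ • (c q * d q) := by
  rw [c_mul_d, inv_smul_smul₀ q.ne_zero]

theorem d_mul_monomial_mem_orderedSpan (i l : ℕ) :
    d q * (a q ^ i * d q ^ l) ∈ orderedSpan q (i + l + 1) := by
  induction i with
  | zero => simpa [pow_succ'] using monomial_mem_orderedSpan (q := q) 0 0 0 (l + 1)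
  | succ i ih =>
    have hda : d q * a q = a q * d q - ((q : ℂ) - (q : ℂ)⁻¹) • (b q * c q) :=
      eq_sub_of_add_eq a_mul_d.symm
    have hbc : b q * (c q * (a q ^ i * d q ^ l)) ∈ orderedSpan q (i + l + 1 + 1) := by
      have := monomial_mem_orderedSpan (q := q) 1 1 i l
      rw [pow_one, pow_one] at this
      convert this using 2
      ring
    rw [pow_succ', mul_assoc, ← mul_assoc, hda, sub_mul, smul_mul_assoc, mul_assoc, mul_assoc,
      add_right_comm i]
    exact sub_mem (a_mul_mem_orderedSpan ih) (Submodule.smul_mem _ _ hbc)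

theorem d_mul_mem_orderedSpan {y : OqMat2 q} (hy : y ∈ orderedSpan q n) :
    d q * y ∈ orderedSpan q (n + 1) := by
  refine mul_mem_orderedSpan_of_forall_monomial (fun j k i l ↦ ?_) hy
  induction j with
  | zero =>
    rw [pow_zero, one_mul]
    induction k with
    | zero => simpa using d_mul_monomial_mem_orderedSpan i l
    | succ k ih =>
      rw [pow_succ', mul_assoc, ← mul_assoc, d_mul_c, smul_mul_assoc, mul_assoc]
      convert Submodule.smul_mem _ _ (c_mul_mem_orderedSpan ih) using 2
      ring
  | succ j ih =>
    rw [pow_succ', mul_assoc, ← mul_assoc, d_mul_b, smul_mul_assoc, mul_assoc]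
    convert Submodule.smul_mem _ _ (b_mul_mem_orderedSpan ih) using 2
    ring

theorem degreePart_le_orderedSpan (n : ℕ) : degreePart q n ≤ orderedSpan q n := by
  induction n with
  | zero =>
    rw [degreePart, pow_zero, Submodule.one_le]
    simpa using monomial_mem_orderedSpan (q := q) 0 0 0 0
  | succ n ih =>
    rw [degreePart, pow_succ', Submodule.mul_le]
    intro x hx y hy
    have hgen : Submodule.span ℂ (Set.range (gen q)) ≤
        (orderedSpan q (n + 1)).comap (LinearMap.mulRight ℂ y) := by
      refine Submodule.span_le.2 ?_
      rintro _ ⟨g, rfl⟩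
      cases g
      exacts [a_mul_mem_orderedSpan (ih hy), b_mul_mem_orderedSpan (ih hy),
        c_mul_mem_orderedSpan (ih hy), d_mul_mem_orderedSpan (ih hy)]
    exact hgen hx

instance (n : ℕ) : FiniteDimensional ℂ (orderedSpan q n) :=
  FiniteDimensional.span_of_finite ℂ ((Finset.finite_toSet _).image _)

theorem finrank_orderedSpan_le (n : ℕ) :
    Module.finrank ℂ (orderedSpan q n) ≤ (n + 3).choose 3 := by
  classical
  calc
    Module.finrank ℂ (orderedSpan q n) ≤
        ((Finset.univ.finsuppAntidiag n).image (orderedMonomial q)).card := by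
      rw [orderedSpan, ← Finset.coe_image]
      exact finrank_span_finset_le_card _
    _ ≤ (Finset.univ.finsuppAntidiag n : Finset (Fin 4 →₀ ℕ)).card := Finset.card_image_le
    _ = (n + 3).choose 3 := by
      rw [Finset.card_finsuppAntidiag_nat_eq_choose, Finset.card_fin, add_comm n 3,
        Nat.choose_symm_add, Nat.add_right_comm 3 1 n, Nat.add_sub_cancel]

instance (n : ℕ) : FiniteDimensional ℂ (degreePart q n) :=
  Submodule.finiteDimensional_of_le (degreePart_le_orderedSpan n)

theorem finrank_degreePart_le (n : ℕ) :
    Module.finrank ℂ (degreePart q n) ≤ (n + 3).choose 3 :=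
  (Submodule.finrank_mono (degreePart_le_orderedSpan n)).trans (finrank_orderedSpan_le n)

theorem gen_mem_degreePart (g : MatGen) : gen q g ∈ degreePart q 1 := by
  rw [degreePart, pow_one]
  exact Submodule.subset_span ⟨g, rfl⟩

theorem mul_mem_degreePart {m n : ℕ} {x y : OqMat2 q} (hx : x ∈ degreePart q m)
    (hy : y ∈ degreePart q n) : x * y ∈ degreePart q (m + n) := by
  rw [degreePart, pow_add]
  exact Submodule.mul_mem_mul hx hy

theorem qdet_mem_degreePart : qdet q ∈ degreePart q 2 :=
  sub_mem (mul_mem_degreePart (gen_mem_degreePart _) (gen_mem_degreePart _))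
    (Submodule.smul_mem _ _ (mul_mem_degreePart (gen_mem_degreePart _) (gen_mem_degreePart _)))

theorem adjoin_range_gen : Algebra.adjoin ℂ (Set.range (gen q)) = ⊤ := by
  have hrange : Set.range (gen q) = mk q '' Set.range (FreeAlgebra.ι ℂ) := by
    rw [← Set.range_comp]
    rfl
  rw [hrange, ← AlgHom.map_adjoin, FreeAlgebra.adjoin_range_ι, Algebra.map_top,
    AlgHom.range_eq_top]
  exact RingQuot.mkAlgHom_surjective ℂ (MatRel q)

theorem iSup_degreePart : ⨆ n, degreePart q n = ⊤ := by
  refine Submodule.eq_top_iff'.2 fun x ↦ ?_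
  have hx : x ∈ Algebra.adjoin ℂ (Set.range (gen q)) := by simp [adjoin_range_gen]
  induction hx using Algebra.adjoin_induction with
  | mem x hx =>
    obtain ⟨g, rfl⟩ := hx
    exact Submodule.mem_iSup_of_mem 1 (gen_mem_degreePart g)
  | algebraMap r =>
    refine Submodule.mem_iSup_of_mem 0 ?_
    rw [degreePart, pow_zero]
    exact Submodule.algebraMap_mem r
  | add x y _ _ hx hy => exact add_mem hx hy
  | mul x y _ _ hx hy =>
    have hmul : (⨆ n, degreePart q n) * ⨆ n, degreePart q n ≤ ⨆ n, degreePart q n := by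
      rw [Submodule.iSup_mul, iSup_le_iff]
      intro m
      rw [Submodule.mul_iSup, iSup_le_iff]
      intro n
      rw [degreePart, degreePart, ← pow_add]
      exact le_iSup (degreePart q) (m + n)
    exact hmul (Submodule.mul_mem_mul hx hy)

end OqMat2

section PeterWeyl

variable {q : ℂˣ}

/-- The span of the matrix coefficients of the modules `𝒱ₘ` with `m ≤ n` and `m ≡ n mod 2`. -/
def coeffFiltration (q : ℂˣ) (n : ℤ) : Submodule ℂ (Uq q →ₗ[ℂ] ℂ) :=
  ⨆ (m : ℕ) (_ : DominanceLE m n), coeffSpace q m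

theorem dominanceLE_natCast_iff {m n : ℕ} : DominanceLE m n ↔ m < n + 1 ∧ m % 2 = n % 2 := by
  constructor
  · rintro ⟨k, hk⟩
    omega
  · rintro ⟨hmn, hparity⟩
    exact ⟨(n - m) / 2, by omega⟩

theorem coeffFiltration_eq_span (n : ℤ) :
    coeffFiltration q n =
      Submodule.span ℂ ((fun x : Σ m : ℕ, Fin (m + 1) × Fin (m + 1) ↦
        basisCoeff q x.1 x.2.1 x.2.2) '' {x | DominanceLE x.1 n}) := by
  simp only [coeffFiltration, ← span_basisCoeff, ← Submodule.span_iUnion]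
  congr 1
  ext f
  simp only [Set.mem_iUnion, Set.mem_range, Set.mem_image, Set.mem_ofPred_eq, Sigma.exists,
    exists_prop, exists_and_left]

theorem finrank_coeffFiltration (hq : ¬IsOfFinOrder q) (n : ℕ) :
    Module.finrank ℂ (coeffFiltration q n) = (n + 3).choose 3 := by
  let s : Finset (Σ m : ℕ, Fin (m + 1) × Fin (m + 1)) :=
    {m ∈ Finset.range (n + 1) | m % 2 = n % 2}.sigma fun _ ↦ Finset.univ
  have hs : {x : Σ m : ℕ, Fin (m + 1) × Fin (m + 1) | DominanceLE x.1 n} = s := by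
    ext x
    simp only [Set.mem_ofPred_eq, dominanceLE_natCast_iff, s, Finset.coe_sigma, Set.mem_sigma_iff,
      Finset.mem_coe, Finset.mem_filter, Finset.mem_range, Finset.mem_univ, and_true]
  have hli := (linearIndependent_basisCoeff hq).comp ((↑) : s → _) Subtype.val_injective
  rw [coeffFiltration_eq_span, hs, Set.image_eq_range]
  refine (finrank_span_eq_card hli).trans ?_
  simp [s, ← sum_sq_eq_choose, sq]

theorem disjoint_coeffFiltration (hq : ¬IsOfFinOrder q) (n : ℤ) :
    Disjoint (coeffFiltration q n) (coeffFiltration q (n + 1)) := by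
  rw [coeffFiltration_eq_span, coeffFiltration_eq_span]
  refine (linearIndependent_basisCoeff hq).disjoint_span_image (Set.disjoint_left.2 ?_)
  rintro x ⟨k, hk⟩ ⟨l, hl⟩
  omega

/-- The linear map underlying the pairing `matPairing` of `O_q(Mat₂)` with `U_q(sl₂)`. -/
def matPairingLinear (q : ℂˣ) : OqMat2 q →ₗ[ℂ] Uq q →ₗ[ℂ] ℂ :=
  (WithConv.linearEquiv ℂ (Uq q →ₗ[ℂ] ℂ)).toLinearMap ∘ₗ (matPairing q).toLinearMap

theorem toConv_matPairingLinear (x : OqMat2 q) :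
    .toConv (matPairingLinear q x) = matPairing q x := rfl

theorem matPairingLinear_qdet_mul (x : OqMat2 q) :
    matPairingLinear q (OqMat2.qdet q * x) = matPairingLinear q x := by
  apply WithConv.toConv_injective
  simp only [toConv_matPairingLinear, map_mul, matPairing_qdet, one_mul]

theorem exists_matPairing_gen_eq_stdCoeff (i j : Fin 2) :
    ∃ g, matPairing q (OqMat2.gen q g) = stdCoeff q i j := by
  simp only [matPairing, OqMat2.lift_gen]
  fin_cases i <;> fin_cases j
  exacts [⟨.a, rfl⟩, ⟨.b, rfl⟩, ⟨.c, rfl⟩, ⟨.d, rfl⟩]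

theorem V.rep_zero (q : ℂˣ) :
    V.rep q 0 = (Algebra.ofId ℂ (Module.End ℂ (V 0))).comp (Uq.counit q) := by
  refine Uq.hom_ext fun g ↦ LinearMap.ext fun v ↦ funext fun i ↦ ?_
  rw [V.rep_gen, AlgHom.comp_apply, Uq.counit_gen, Algebra.ofId_apply, Module.algebraMap_end_apply]
  fin_cases i
  cases g <;> simp [V.opGen, V.opE_apply, V.opF_apply, V.opK_apply, V.opKinv_apply, Uq.counitGen]

theorem coeffSpace_zero_le_map :
    coeffSpace q 0 ≤ (OqMat2.degreePart q 0).map (matPairingLinear q) := by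
  rw [coeffSpace, Submodule.span_le]
  rintro _ ⟨φ, v, rfl⟩
  refine ⟨algebraMap ℂ _ (φ v), ?_, ?_⟩
  · rw [OqMat2.degreePart, pow_zero]
    exact Submodule.algebraMap_mem _
  · ext u
    rw [matrixCoeff_apply, V.rep_zero, AlgHom.comp_apply, Algebra.ofId_apply,
      Module.algebraMap_end_apply, map_smul, smul_eq_mul, mul_comm, Algebra.algebraMap_eq_smul_one,
      map_smul, LinearMap.smul_apply, smul_eq_mul, ← WithConv.ofConv_toConv (matPairingLinear q 1),
      toConv_matPairingLinear, map_one]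
    rfl

theorem exists_basisCoeff_succ (m : ℕ) (i j : Fin (m + 2)) :
    ∃ f₀ ∈ coeffSpace q m, ∃ f₁ ∈ coeffSpace q m, ∃ k : Fin 2,
      .toConv (basisCoeff q (m + 1) i j) =
        stdCoeff q k 0 * .toConv f₀ + stdCoeff q k 1 * .toConv f₁ := by
  have hmem (φ v) : matrixCoeff q m φ v ∈ coeffSpace q m := Submodule.subset_span ⟨φ, v, rfl⟩
  cases i using Fin.lastCases with
  | last => exact ⟨_, hmem _ _, _, hmem _ _, 1, matrixCoeff_proj_last _⟩
  | cast i => exact ⟨_, hmem _ _, _, hmem _ _, 0, matrixCoeff_proj_castSucc i _⟩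

theorem coeffSpace_le_map (m : ℕ) :
    coeffSpace q m ≤ (OqMat2.degreePart q m).map (matPairingLinear q) := by
  induction m with
  | zero => exact coeffSpace_zero_le_map
  | succ m ih =>
    rw [← span_basisCoeff, Submodule.span_le]
    rintro _ ⟨⟨i, j⟩, rfl⟩
    obtain ⟨f₀, hf₀, f₁, hf₁, k, recursion⟩ := exists_basisCoeff_succ (q := q) m i j
    obtain ⟨x₀, hx₀, rfl⟩ := ih hf₀
    obtain ⟨x₁, hx₁, rfl⟩ := ih hf₁
    obtain ⟨g₀, hg₀⟩ := exists_matPairing_gen_eq_stdCoeff (q := q) k 0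
    obtain ⟨g₁, hg₁⟩ := exists_matPairing_gen_eq_stdCoeff (q := q) k 1
    refine ⟨OqMat2.gen q g₀ * x₀ + OqMat2.gen q g₁ * x₁, ?_, WithConv.toConv_injective ?_⟩
    · rw [add_comm m 1]
      exact add_mem (OqMat2.mul_mem_degreePart (OqMat2.gen_mem_degreePart _) hx₀)
        (OqMat2.mul_mem_degreePart (OqMat2.gen_mem_degreePart _) hx₁)
    · rw [recursion, toConv_matPairingLinear, map_add, map_mul, map_mul, hg₀, hg₁,
        toConv_matPairingLinear, toConv_matPairingLinear]

theorem coeffFiltration_le_map (n : ℕ) :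
    coeffFiltration q n ≤ (OqMat2.degreePart q n).map (matPairingLinear q) := by
  have add_two (n : ℕ) : (OqMat2.degreePart q n).map (matPairingLinear q) ≤
      (OqMat2.degreePart q (2 + n)).map (matPairingLinear q) := by
    rintro _ ⟨x, hx, rfl⟩
    exact ⟨_, OqMat2.mul_mem_degreePart OqMat2.qdet_mem_degreePart hx, matPairingLinear_qdet_mul x⟩
  refine iSup₂_le fun m hm ↦ (coeffSpace_le_map m).trans ?_
  obtain ⟨k, rfl⟩ : ∃ k, n = m + 2 * k := hm.imp fun k hk ↦ by omega
  clear hm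
  induction k with
  | zero => rfl
  | succ k ih =>
    rw [show m + 2 * (k + 1) = 2 + (m + 2 * k) by ring]
    exact ih.trans (add_two _)

theorem map_matPairingLinear_eq_and_disjoint_ker (hq : ¬IsOfFinOrder q) (n : ℕ) :
    (OqMat2.degreePart q n).map (matPairingLinear q) = coeffFiltration q n ∧
      Disjoint (OqMat2.degreePart q n) (matPairingLinear q).ker :=
  map_eq_and_disjoint_ker_of_finrank_le _ (coeffFiltration_le_map n)
    (OqMat2.finrank_degreePart_le n |>.trans_eq (finrank_coeffFiltration hq n).symm)

theorem exists_mem_map_degreePart_sup (y : OqSL2 q) :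
    ∃ n : ℕ, y ∈ (OqMat2.degreePart q n ⊔ OqMat2.degreePart q (n + 1)).map
      (OqSL2.mk q).toLinearMap := by
  let R (n : ℕ) : Submodule ℂ (OqSL2 q) := (OqMat2.degreePart q n).map (OqSL2.mk q).toLinearMap
  have add_two (n : ℕ) : R n ≤ R (n + 2) := by
    rintro _ ⟨x, hx, rfl⟩
    refine ⟨_, OqMat2.mul_mem_degreePart hx OqMat2.qdet_mem_degreePart, ?_⟩
    simp only [AlgHom.toLinearMap_apply, map_mul, OqSL2.mk_qdet, mul_one]
  have hmono : Monotone fun n ↦ R n ⊔ R (n + 1) :=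
    monotone_nat_of_le_succ fun n ↦ sup_le ((add_two n).trans le_sup_right) le_sup_left
  obtain ⟨x, rfl⟩ := RingQuot.mkAlgHom_surjective ℂ (DetRel q) y
  have hx : x ∈ ⨆ n, OqMat2.degreePart q n := by simp [OqMat2.iSup_degreePart]
  have hsup : ⨆ n, OqMat2.degreePart q n ≤
      (⨆ n, R n ⊔ R (n + 1)).comap (OqSL2.mk q).toLinearMap :=
    iSup_le fun n ↦ Submodule.map_le_iff_le_comap.1 (le_iSup_of_le n le_sup_left)
  simp only [Submodule.map_sup]
  exact (Submodule.mem_iSup_of_directed _ hmono.directed_le).1 (hsup hx)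

theorem toConv_matPairingLinear_eq_pairing (x : OqMat2 q) :
    .toConv (matPairingLinear q x) = pairing q (OqSL2.mk q x) :=
  (OqSL2.lift_mk _ _ _).symm

theorem pairing_injective (hq : ¬IsOfFinOrder q) : Function.Injective (pairing q) := by
  refine (injective_iff_map_eq_zero _).2 fun y hy ↦ ?_
  obtain ⟨n, _, hx, rfl⟩ := exists_mem_map_degreePart_sup y
  obtain ⟨x₀, hx₀, x₁, hx₁, rfl⟩ := Submodule.mem_sup.1 hx
  rw [AlgHom.toLinearMap_apply, ← toConv_matPairingLinear_eq_pairing, WithConv.toConv_eq_zero,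
    map_add] at hy
  obtain ⟨map_n, ker_n⟩ := map_matPairingLinear_eq_and_disjoint_ker hq n
  obtain ⟨map_succ, ker_succ⟩ := map_matPairingLinear_eq_and_disjoint_ker hq (n + 1)
  have hdisj := disjoint_coeffFiltration hq n
  rw [← map_n, ← Nat.cast_succ, ← map_succ] at hdisj
  have h₀ : matPairingLinear q x₀ = 0 := by
    refine Submodule.disjoint_def.1 hdisj _ ⟨x₀, hx₀, rfl⟩ ?_
    rw [eq_neg_of_add_eq_zero_left hy]
    exact neg_mem ⟨x₁, hx₁, rfl⟩
  rw [h₀, zero_add] at hy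
  rw [Submodule.disjoint_def.1 ker_n _ hx₀ h₀, Submodule.disjoint_def.1 ker_succ _ hx₁ hy, add_zero,
    map_zero]

theorem peterWeyl_eq_map_degreePart (hq : ¬IsOfFinOrder q) (n : ℕ) :
    peterWeyl q n = (OqMat2.degreePart q n).map (OqSL2.mk q).toLinearMap := by
  ext y
  change (pairing q y).ofConv ∈ coeffFiltration q n ↔ _
  rw [← (map_matPairingLinear_eq_and_disjoint_ker hq n).1]
  refine exists_congr fun x ↦ and_congr_right fun _ ↦ ?_
  rw [AlgHom.toLinearMap_apply, ← (pairing_injective hq).eq_iff,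
    ← toConv_matPairingLinear_eq_pairing, ← WithConv.toConv_injective.eq_iff,
    WithConv.toConv_ofConv]

theorem disjoint_degreePart_ker_mk (hq : ¬IsOfFinOrder q) (n : ℕ) :
    Disjoint (OqMat2.degreePart q n) (OqSL2.mk q).toLinearMap.ker := by
  refine (map_matPairingLinear_eq_and_disjoint_ker hq n).2.mono_right fun x hx ↦ ?_
  rw [LinearMap.mem_ker, AlgHom.toLinearMap_apply] at hx
  rw [LinearMap.mem_ker, ← WithConv.toConv_eq_zero, toConv_matPairingLinear_eq_pairing, hx,
    map_zero]

end PeterWeyl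

section Homogenization

variable {q : ℂˣ}

/-- The algebra homomorphism `O_q(Mat₂) → O_q(SL₂)[z]` that multiplies each generator by `z`. -/
def toOqSL2z (q : ℂˣ) : OqMat2 q →ₐ[ℂ] OqSL2z q := by
  refine OqMat2.lift (fun g ↦ AddMonoidAlgebra.single 1 (OqSL2.mk q (OqMat2.gen q g)))
    ?_ ?_ ?_ ?_ ?_ (sub_eq_iff_eq_add'.2 ?_) <;>
  simp only [AddMonoidAlgebra.single_mul_single, AddMonoidAlgebra.smul_single, ← map_mul,
    ← map_smul, ← AddMonoidAlgebra.single_add, ← map_add]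
  exacts [by rw [OqMat2.a_mul_b], by rw [OqMat2.a_mul_c], by rw [OqMat2.c_mul_b],
    by rw [OqMat2.b_mul_d], by rw [OqMat2.c_mul_d], by rw [OqMat2.a_mul_d]]

theorem toOqSL2z_gen (g : MatGen) :
    toOqSL2z q (OqMat2.gen q g) = AddMonoidAlgebra.single 1 (OqSL2.mk q (OqMat2.gen q g)) := by
  rw [toOqSL2z, OqMat2.lift_gen]

theorem toOqSL2z_of_mem_degreePart {n : ℕ} {x : OqMat2 q} (hx : x ∈ OqMat2.degreePart q n) :
    toOqSL2z q x = AddMonoidAlgebra.single n (OqSL2.mk q x) := by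
  have degree_one : ∀ x ∈ Submodule.span ℂ (Set.range (OqMat2.gen q)),
      toOqSL2z q x = AddMonoidAlgebra.single 1 (OqSL2.mk q x) := fun x hx ↦
    LinearMap.eqOn_span (f := (toOqSL2z q).toLinearMap)
      (g := AddMonoidAlgebra.lsingle 1 ∘ₗ (OqSL2.mk q).toLinearMap)
      (Set.forall_mem_range.2 toOqSL2z_gen) hx
  induction hx using Submodule.pow_induction_on_left' with
  | algebraMap r => simp
  | add x y n _ _ hx hy => rw [map_add, hx, hy, map_add, AddMonoidAlgebra.single_add]
  | mem_mul x hx n y _ hy =>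
    rw [map_mul, degree_one x hx, hy, AddMonoidAlgebra.single_mul_single, ← map_mul, add_comm 1]

theorem OqSL2.comul_mk_gen (g : MatGen) :
    Coalgebra.comul (R := ℂ) (OqSL2.mk q (OqMat2.gen q g)) =
      TensorProduct.map (OqSL2.mk q).toLinearMap (OqSL2.mk q).toLinearMap
        (OqMat2.comulGen q g) := by
  change OqSL2.comul q _ = _
  rw [OqSL2.comul, OqSL2.lift_mk, AlgHom.comp_apply, OqMat2.comul_gen]
  rfl

/-- The homomorphism `toOqSL2z` as a homomorphism of bialgebras. -/
def toOqSL2zBialgHom (q : ℂˣ) : OqMat2 q →ₐc[ℂ] OqSL2z q :=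
  BialgHom.ofAlgHom (toOqSL2z q)
    (OqMat2.hom_ext fun g ↦ by
      change Coalgebra.counit (R := ℂ) (toOqSL2z q (OqMat2.gen q g)) =
        OqMat2.counit q (OqMat2.gen q g)
      rw [toOqSL2z_gen, AddMonoidAlgebra.counit_single]
      change OqSL2.counit q _ = _
      rw [OqSL2.counit, OqSL2.lift_mk])
    (OqMat2.hom_ext fun g ↦ by
      change Algebra.TensorProduct.map _ _ (OqMat2.comul q (OqMat2.gen q g)) =
        Coalgebra.comul (R := ℂ) (toOqSL2z q (OqMat2.gen q g))
      rw [toOqSL2z_gen, AddMonoidAlgebra.comul_single, OqSL2.comul_mk_gen, OqMat2.comul_gen]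
      cases g <;> simp [OqMat2.comulGen, toOqSL2z_gen])

theorem toOqSL2z_qdet : toOqSL2z q (OqMat2.qdet q) = AddMonoidAlgebra.single 2 1 := by
  rw [toOqSL2z_of_mem_degreePart OqMat2.qdet_mem_degreePart, OqSL2.mk_qdet]

theorem toOqSL2z_injective (hq : ¬IsOfFinOrder q) : Function.Injective (toOqSL2z q) := by
  refine (injective_iff_map_eq_zero _).2 fun x h ↦ ?_
  have hx : x ∈ ⨆ n, OqMat2.degreePart q n := by simp [OqMat2.iSup_degreePart]
  obtain ⟨f, hf, rfl⟩ := (Submodule.mem_iSup_iff_exists_finsupp _ _).1 hx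
  refine Finset.sum_eq_zero fun n hn ↦
    Submodule.disjoint_def.1 (disjoint_degreePart_ker_mk hq n) _ (hf n) ?_
  have hcoeff := congrArg (fun p : OqSL2z q ↦ p.coeff n) h
  simpa [Finsupp.sum, toOqSL2z_of_mem_degreePart (hf _), Finsupp.single_apply,
    Finsupp.mem_support_iff.1 hn] using hcoeff

theorem range_toOqSL2z (hq : ¬IsOfFinOrder q) :
    Subalgebra.toSubmodule (toOqSL2z q).range = rees q := by
  apply le_antisymm
  · have degreePart_le (n : ℕ) :
        OqMat2.degreePart q n ≤ (rees q).comap (toOqSL2z q).toLinearMap := by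
      intro x hx k
      rw [AlgHom.toLinearMap_apply, toOqSL2z_of_mem_degreePart hx, AddMonoidAlgebra.coeff_single]
      obtain rfl | hnk := eq_or_ne n k
      · rw [peterWeyl_eq_map_degreePart hq, Finsupp.single_eq_same]
        exact ⟨x, hx, rfl⟩
      · rw [Finsupp.single_eq_of_ne' hnk]
        exact zero_mem _
    have top_le := iSup_le degreePart_le
    rw [OqMat2.iSup_degreePart] at top_le
    rintro _ ⟨x, rfl⟩
    exact top_le Submodule.mem_top
  · intro p hp
    rw [← AddMonoidAlgebra.sum_coeff_single p]
    refine sum_mem fun n _ ↦ ?_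
    have hn := hp n
    rw [peterWeyl_eq_map_degreePart hq] at hn
    obtain ⟨x, hx, mk_x⟩ := hn
    exact ⟨x, (toOqSL2z_of_mem_degreePart hx).trans (congrArg _ mk_x)⟩

end Homogenization

end QuantumSL2

end

/-- For `q` nonzero and not a root of unity, the subspace `⨁ₙ O_q(SL₂)_{≤ n} z ^ n` is a
sub-bialgebra of `O_q(SL₂)[z]`, and it is isomorphic as a bialgebra to `O_q(Mat₂)`, by an
isomorphism under which `z ^ 2` corresponds to the quantum determinant. -/
theorem mainTheorem5 (q : ℂˣ) (hq : ∀ n : ℕ, 0 < n → q ^ n ≠ 1) :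
    ∃ S : QuantumSL2.SubBialgebra (QuantumSL2.OqSL2z q),
      Subalgebra.toSubmodule S.toSubalgebra = QuantumSL2.rees q ∧
      ∃ e : S.toSubalgebra ≃ₐc[ℂ] QuantumSL2.OqMat2 q,
        ((e.symm (QuantumSL2.OqMat2.qdet q) : S.toSubalgebra) : QuantumSL2.OqSL2z q) =
          AddMonoidAlgebra.single 2 (1 : QuantumSL2.OqSL2 q) := by
  have not_root_of_unity : ¬IsOfFinOrder q := fun h ↦
    let ⟨n, hn, hqn⟩ := isOfFinOrder_iff_pow_eq_one.1 h
    hq n hn hqn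
  have injective := QuantumSL2.toOqSL2z_injective not_root_of_unity
  exact ⟨QuantumSL2.SubBialgebra.range (QuantumSL2.toOqSL2zBialgHom q) injective,
    QuantumSL2.range_toOqSL2z not_root_of_unity,
    (QuantumSL2.SubBialgebra.equivRange _ injective).symm, QuantumSL2.toOqSL2z_qdet⟩
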